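/- **Conventions.** For integers $b,n\ge 1$ let $b^{<n}$, $b^n$, $b^{\le n}$ be the sets of finite sequences in $\{0,\dots,b-1\}$ of length $<n$, $=n$, $\le n$ respectively; $|s|$ is the length of $s$, $\sqsubseteq$ is the initial segment order, and $s\le_{\mathrm{lex}}t$ means that $s\sqsubseteq t$, or $s,t$ are $\sqsubseteq$-incomparable and $s$ has the smaller entry at the first place where they differ. A subtree $S$ is a set of such sequences. For $s\in S$, the height $\mathrm h_S(s)$ is the number of proper initial segments of $s$ in $S$, $S(m)=\{s\in S:\mathrm h_S(s)=m\}$, and $\mathrm{ImSucc}_S(s)$ is the set of $\sqsubseteq$-minimal elements of $\{t\in S:s\sqsubsetneq t\}$. For $k\ge1$, $S$ is a *$k$-complete skew subtree* if: $S$ has a $\sqsubseteq$-minimum and every maximal $\sqsubseteq$-chain of $S$ has $k$ elements; $|s|\le|s'|$ whenever $s,s'\in S$, $\mathrm h_S(s)=\mathrm h_S(s')$ and $s\le_{\mathrm{lex}}s'$; $|s|<|s'|$ whenever $s,s'\in S$ and $\mathrm h_S(s)<\mathrm h_S(s')$; and for every non-maximal $s\in S$ and every $i<b$ there is a unique $t\in\mathrm{ImSucc}_S(s)$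 with $s^\smallfrown(i)\sqsubseteq t$. A tuple $(S_1,\dots,S_d)$ is a *vector $k$-complete skew subtree* if each $S_i$ is a $k$-complete skew subtree; $|s|\le|s'|$ for all $i<j$, $0\le m<k$, $s\in S_i(m)$, $s'\in S_j(m)$; and $|s|<|s'|$ for all $i,j$, $0\le m<k-1$, $s\in S_i(m)$, $s'\in S_j(m+1)$. Let $\Lambda$ be a finite alphabet and let $v_s$ $(s\in b^{<n})$ be distinct symbols not in $\Lambda$. Put $W(b,n,\Lambda)=\Lambda^{b^{<n}}$. A *$k$-dimensional variable word* is a map $f:b^{<n}\to\Lambda\cup\{v_t:t\in T\}$, where $T\subseteq b^{<n}$ is a $k$-complete skew subtree and for each $t\in T$ the set $f^{-1}(v_t)$ is non-empty with $\sqsubseteq$-minimum $t$; then $T$ is determined by $f$ and is denoted $\mathrm{ws}(f)$. Its span $[f]_\Lambda\subseteq W(b,n,\Lambda)$ is the set of all words obtained from $f$ by substituting, for every $t\in\mathrm{ws}(f)$, a letter $\alpha_t\in\Lambda$ for all occurrences of $v_t$. For $d\ge1$ and a partition $\mathbf D=(D_0,D_1,D_2)$ of $[d]=\{1,\dots,d\}$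 (empty parts allowed), let $W^{\mathbf D}(b,n,\Lambda)$ be the set of all triples $$\big((w_i)_{i\in[d]},(x_i)_{i\in D_1},(t_i)_{i\in D_2}\big),\qquad w_i\in W(b,n,\Lambda),\ x_i\in b^n,\ t_i\in b^{<n}.$$ A *$k$-dimensional combinatorial subspace* of $W^{\mathbf D}(b,n,\Lambda)$ is given by $k$-dimensional variable words $f_1,\dots,f_d$ such that $(\mathrm{ws}(f_i))_{i\in[d]}$ is a vector $k$-complete skew subtree, together with sets $X_i\subseteq b^n$ $(i\in D_1)$ with $|X_i|=b^k$ such that $\mathrm{ws}(f_i)\cup X_i$ is a $(k+1)$-complete skew subtree of $b^{\le n}$; it consists of all triples as above with $w_i\in[f_i]_\Lambda$ for $i\in[d]$, $x_i\in X_i$ for $i\in D_1$ and $t_i\in\mathrm{ws}(f_i)$ for $i\in D_2$. For a coloring $c$ of $W^{\mathbf D}(b,n,\Lambda)$ the subspace is *$c$-good* if $$c\big((w_i)_{i},(x_i)_{i},(t_i)_{i}\big)=c\big((w'_i)_{i},(x'_i)_{i},(t'_i)_{i}\big)$$ for any two of its elements satisfying $t_i=t'_i$ and $w_i(t_i)=w'_i(t'_i)$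 for all $i\in D_2$. **Theorem.** Let $d_0,d_1,d_2\ge 0$ be integers with $d_0+d_1+d_2\ge1$ and let $b,\ell,k,r$ be positive integers. There is a positive integer $n_0$ such that for every alphabet $\Lambda$ with $\ell$ elements, every integer $n\ge n_0$, every partition $\mathbf D=(D_0,D_1,D_2)$ of $[d_0+d_1+d_2]$ with $|D_j|=d_j$ for $j=0,1,2$, and every coloring $c$ of $W^{\mathbf D}(b,n,\Lambda)$ with $r$ colors, there is a $k$-dimensional $c$-good combinatorial subspace of $W^{\mathbf D}(b,n,\Lambda)$. -/

import Mathlib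

namespace TreeHJ

/-! ### Finite sequences and subtrees

Finite sequences in `{0, …, b - 1}` are lists over `Fin b`; the initial segment ordering is
`s <+: t`. A subtree is a set of finite sequences. -/

/-- The tree `b^{<n}` of sequences of length less than `n`. -/
abbrev Node (b n : ℕ) : Type := {s : List (Fin b) // s.length < n}

/-- The set `b^n` of sequences of length exactly `n`. -/
abbrev Leaf (b n : ℕ) : Type := {s : List (Fin b) // s.length = n}

/-- The (reflexive) lexicographical order: either `s` is an initial segment of `t`, or `s` and `t`
are incomparable and, at the first place where they differ, `s` has the smaller entry. -/
def LexLE {b : ℕ} (s t : List (Fin b)) : Prop :=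
  s <+: t ∨ ∃ (p : List (Fin b)) (i j : Fin b) (u v : List (Fin b)),
    i < j ∧ s = p ++ i :: u ∧ t = p ++ j :: v

/-- The strict predecessors of `s` inside the subtree `S`. -/
def pred {b : ℕ} (S : Set (List (Fin b))) (s : List (Fin b)) : Set (List (Fin b)) :=
  {t | t ∈ S ∧ t <+: s ∧ t ≠ s}

/-- The height of `s` inside the subtree `S`. The set `pred S s` is always finite. -/
noncomputable def ht {b : ℕ} (S : Set (List (Fin b))) (s : List (Fin b)) : ℕ :=
  (pred S s).ncard

/-- The immediate successors of `s` inside the subtree `S`. -/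
def imSucc {b : ℕ} (S : Set (List (Fin b))) (s : List (Fin b)) : Set (List (Fin b)) :=
  {t | t ∈ S ∧ s <+: t ∧ s ≠ t ∧
    ¬ ∃ t' ∈ S, (s <+: t' ∧ s ≠ t') ∧ (t' <+: t ∧ t' ≠ t)}

/-- The `m`-th level of the subtree `S`. -/
def level {b : ℕ} (S : Set (List (Fin b))) (m : ℕ) : Set (List (Fin b)) :=
  {s | s ∈ S ∧ ht S s = m}

/-- `S` is a `k`-complete skew subtree. -/
structure IsCompleteSkew {b : ℕ} (k : ℕ) (S : Set (List (Fin b))) : Prop where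
  exists_min : ∃ r ∈ S, ∀ s ∈ S, r <+: s
  maximal_chain : ∀ C : Set (List (Fin b)),
    Maximal (fun C' => C' ⊆ S ∧ IsChain (fun s t => s <+: t) C') C → C.ncard = k
  same_level : ∀ s ∈ S, ∀ s' ∈ S, ht S s = ht S s' → LexLE s s' → s.length ≤ s'.length
  lower_level : ∀ s ∈ S, ∀ s' ∈ S, ht S s < ht S s' → s.length < s'.length
  branching : ∀ s ∈ S, (∃ t ∈ S, s <+: t ∧ s ≠ t) →
    ∀ i : Fin b, ∃! t, t ∈ imSucc S s ∧ (s ++ [i]) <+: t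

/-- The tuple `S` is a vector `k`-complete skew subtree. -/
structure IsVectorCompleteSkew {b d : ℕ} (k : ℕ) (S : Fin d → Set (List (Fin b))) : Prop where
  complete : ∀ i, IsCompleteSkew k (S i)
  same_level : ∀ i j : Fin d, i < j → ∀ m < k, ∀ s ∈ level (S i) m, ∀ s' ∈ level (S j) m,
    s.length ≤ s'.length
  next_level : ∀ i j : Fin d, ∀ m, m + 1 < k → ∀ s ∈ level (S i) m, ∀ s' ∈ level (S j) (m + 1),
    s.length < s'.length

/-! ### Words and variable words -/

/-- The set `W(b, n, Λ)` of all maps from `b^{<n}` to `Λ`. -/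
abbrev Word (b n : ℕ) (Λ : Type*) : Type _ := Node b n → Λ

/-- Maps from `b^{<n}` to `Λ ∪ {v_s : s ∈ b^{<n}}`; the letter `a` is `Sum.inl a`, the variable
`v_s` is `Sum.inr s`. -/
abbrev PreVarWord (b n : ℕ) (Λ : Type*) : Type _ := Node b n → Λ ⊕ Node b n

section VarWords

variable {b n : ℕ} {Λ : Type*}

/-- `f` is a `T`-variable word: only the variables `v_t` with `t ∈ T` occur in `f`, and for every
`t ∈ T` the set `f⁻¹(v_t)` has `t` as its minimum (in particular it is non-empty). -/
def IsVarWordOn (T : Set (Node b n)) (f : PreVarWord b n Λ) : Prop :=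
  (∀ s t, f s = Sum.inr t → t ∈ T) ∧
  ∀ t ∈ T, f t = Sum.inr t ∧ ∀ s, f s = Sum.inr t → t.1 <+: s.1

/-- The set of all `t` such that the variable `v_t` occurs in `f`. -/
def ws (f : PreVarWord b n Λ) : Set (Node b n) := {t | ∃ s, f s = Sum.inr t}

/-- The same set, as a set of finite sequences. -/
def wsTree (f : PreVarWord b n Λ) : Set (List (Fin b)) := Subtype.val '' ws f

/-- If `f` is a `T`-variable word then `T = ws f`. -/
theorem IsVarWordOn.ws_eq {T : Set (Node b n)} {f : PreVarWord b n Λ} (h : IsVarWordOn T f) :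
    ws f = T := by
  ext t
  exact ⟨fun ⟨s, hs⟩ => h.1 s t hs, fun ht => ⟨t, (h.2 t ht).1⟩⟩

/-- `f` belongs to `W_{v,k}(b, n, Λ)`: it is a `T`-variable word for some `k`-complete skew subtree
`T` of `b^{<n}`, which is then `ws f`. -/
def IsVarWord (k : ℕ) (f : PreVarWord b n Λ) : Prop :=
  IsCompleteSkew k (wsTree f) ∧ IsVarWordOn (ws f) f

/-- Substitution of the letter `a t` for every occurrence of `v_t`, for all `t ∈ ws f`
(the values of `a` outside `ws f` play no role). -/
def subst (f : PreVarWord b n Λ) (a : Node b n → Λ) : Word b n Λ :=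
  fun s => Sum.elim id a (f s)

/-- The combinatorial subspace `[f]_Λ`. -/
def span (f : PreVarWord b n Λ) : Set (Word b n Λ) := Set.range (subst f)

/-- The pair `(f, X)` describes a `k`-dimensional subspace of `W(b, n, Λ) × b^n`. As `X` has
exactly `b ^ k` elements, the skew subtree `ws f ∪ X` of `b^{≤n}` is necessarily complete, with `X`
as its last level. -/
def IsVarWordUp (k : ℕ) (f : PreVarWord b n Λ) (X : Set (Leaf b n)) : Prop :=
  IsVarWord k f ∧ X.ncard = b ^ k ∧ IsCompleteSkew (k + 1) (wsTree f ∪ Subtype.val '' X)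

end VarWords

/-! ### Mixed products -/

/-- A partition `(D₀, D₁, D₂)` of the index set; parts may be empty. -/
structure MixedPartition (d : ℕ) where
  D₀ : Finset (Fin d)
  D₁ : Finset (Fin d)
  D₂ : Finset (Fin d)
  disjoint₀₁ : Disjoint D₀ D₁
  disjoint₀₂ : Disjoint D₀ D₂
  disjoint₁₂ : Disjoint D₁ D₂
  union_eq : D₀ ∪ D₁ ∪ D₂ = Finset.univ

/-- The mixed product `W^D(b, n, Λ)`: triples `((w_i)_{i ∈ [d]}, (x_i)_{i ∈ D₁}, (t_i)_{i ∈ D₂})`.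
-/
@[ext]
structure MixedWord {d : ℕ} (D : MixedPartition d) (b n : ℕ) (Λ : Type*) where
  w : Fin d → Word b n Λ
  x : {i // i ∈ D.D₁} → Leaf b n
  t : {i // i ∈ D.D₂} → Node b n

section Mixed

variable {d : ℕ} {D : MixedPartition d} {b n : ℕ} {Λ : Type*}

/-- `((f_i)_{i ∈ [d]}, (X_i)_{i ∈ D₁})` is a variable word of `W^D(b, n, Λ)` of dimension `k`. -/
structure IsMixedVarWord (k : ℕ) (f : Fin d → PreVarWord b n Λ)
    (X : {i // i ∈ D.D₁} → Set (Leaf b n)) : Prop where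
  varWord : ∀ i, IsVarWord k (f i)
  vector : IsVectorCompleteSkew k (fun i => wsTree (f i))
  up : ∀ i : {i // i ∈ D.D₁}, IsVarWordUp k (f i) (X i)

/-- The combinatorial subspace of `W^D(b, n, Λ)` generated by
`((f_i)_{i ∈ [d]}, (X_i)_{i ∈ D₁})`. -/
def mixedSpan (f : Fin d → PreVarWord b n Λ) (X : {i // i ∈ D.D₁} → Set (Leaf b n)) :
    Set (MixedWord D b n Λ) :=
  {z | (∀ i : Fin d, z.w i ∈ span (f i)) ∧ (∀ i : {i // i ∈ D.D₁}, z.x i ∈ X i) ∧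
    ∀ i : {i // i ∈ D.D₂}, z.t i ∈ ws (f i)}

/-- The set `A` is `c`-good: on `A` the colour depends only on the nodes `t_i` and the letters
`w_i(t_i)`, for `i ∈ D₂`. -/
def IsGood {κ : Type*} (c : MixedWord D b n Λ → κ) (A : Set (MixedWord D b n Λ)) : Prop :=
  ∀ z ∈ A, ∀ z' ∈ A,
    (∀ i : {i // i ∈ D.D₂}, z.t i = z'.t i ∧ z.w i (z.t i) = z'.w i (z'.t i)) → c z = c z'

end Mixed

end TreeHJ

/-! # A Hales–Jewett theorem for mixed products of trees

All mixed products are treated at once: a colouring of tuples of words and of sequences of length at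
most `n` is made good by passing to an embedding of trees of height `k`. First the colour is made
insensitive to the letters off the given sequences, one level at a time; then one more application
of the sequential Hales–Jewett theorem handles the remaining letters and directions.
-/

/-! Every element of a mixed product is coded by a pair `(a, z)`: a tuple of words and a tuple of
sequences, where `z i` is a leaf for `i ∈ D₁`, a shorter node for `i ∈ D₂`, and is ignored for `i ∈
D₀`. It suffices to find one embedding of trees for which the induced colour ignores everything
except, at the indices where `z i` is not a leaf, the node `z i` and its letter (`exists_good`).

The engine is `exists_sequential`, an iterated Hales–Jewett theorem with one block per variable. The
colouring may see a parameter `e`, and also the letters and first positions of the variables in `R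
e`; it is made independent of the letters of all other variables.

In the first application (`exists_step`) the variables are the nodes of one level in all trees, and
`R e` consists of those below `z`. This removes the influence of the letters of that level off `z`.
Levels are treated from the top down (`exists_insens`): nodes above the block and off `z` are placed
according to first positions that the colouring must not see, so the colour must already ignore
their letters.

In the second application (`exists_good_of_insens`) only the paths to `z` and the letters along them
still matter. A path with its letters is a sequence over `Λ × Fin b`, and there is one variable for
each height and tree. Now `R e` contains just the heights at which a non-leaf `z i` ends; no
direction is chosen there, so only the letter at the end survives.

Finally, `IsTreeMap.isCompleteSkew` shows that the images of the trees are complete skew subtrees,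
and `exists_preimage` pulls the subspace back to the small trees. -/

namespace TreeHJ

/-! ### The sequential Hales–Jewett theorem. -/

/-- Substitution of the letters `α q` for the variables `q` of the word `L`. -/
def fill {A Q : Type*} (L : ℕ → A ⊕ Q) (α : Q → A) (x : ℕ) : A := Sum.elim id α (L x)

/-- The Hales–Jewett theorem for words indexed by an initial segment of `ℕ`, with the first
position of the wildcard made explicit. -/
theorem exists_line (A κ : Type) [Finite A] [Nonempty A] [Finite κ] :
    ∃ N : ℕ, ∀ C : (ℕ → A) → κ, (∀ u u', (∀ x < N, u x = u' x) → C u = C u') →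
      ∃ (L : ℕ → Option A) (p : ℕ), L p = none ∧ (∀ x, L x = none → p ≤ x ∧ x < N) ∧
        ∀ a a', C (fun x => (L x).getD a) = C (fun x => (L x).getD a') := by
  classical
  obtain ⟨ι, _, hι⟩ := Combinatorics.Line.exists_mono_in_high_dimension A κ
  let φ := Fintype.equivFin ι
  let a₀ : A := Classical.arbitrary A
  refine ⟨Fintype.card ι, fun C hC => ?_⟩
  obtain ⟨l, k, hl⟩ := hι fun v =>
    C fun x => if h : x < Fintype.card ι then v (φ.symm ⟨x, h⟩) else a₀
  let L : ℕ → Option A := fun x =>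
    if h : x < Fintype.card ι then l.idxFun (φ.symm ⟨x, h⟩) else some a₀
  have hex : ∃ x, L x = none := by
    obtain ⟨i, hi⟩ := l.proper
    exact ⟨φ i, by simp [L, hi]⟩
  refine ⟨L, Nat.find hex, Nat.find_spec hex, fun x hx => ⟨Nat.find_min' hex hx, ?_⟩, ?_⟩
  · by_contra h
    simp [L, h] at hx
  · have key : ∀ a, C (fun x => (L x).getD a) = k := by
      intro a
      rw [← hl a]
      apply hC
      intro x hx
      simp [L, hx]
    intro a a'
    rw [key, key]

/-- Induction on the number of variables. The later blocks are treated with the contents of the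
first block and the position of its variable as extra parameters, hence uniformly in them;
Hales–Jewett then fixes the first block. The map `blk` comes before `C` because the colourings to
which the result is applied are defined through `blk`. -/
theorem exists_sequential_fin (A : Type) [Finite A] [Nonempty A] (κ : Type) [Finite κ] (m : ℕ) :
    ∀ (E : Type) [Finite E] (R : E → Set (Fin m)),
    ∃ (N : ℕ) (blk : ℕ → Option (Fin m)), ∀ C : (ℕ → A) → (Fin m → ℕ) → E → κ,
      (∀ u u' τ τ' e, (∀ x < N, u x = u' x) → (∀ q ∈ R e, τ q = τ' q) → C u τ e = C u' τ' e) →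
      ∃ (L : ℕ → A ⊕ Fin m) (τ : Fin m → ℕ), StrictMono τ ∧ (∀ q, L (τ q) = Sum.inr q) ∧
        (∀ x q, L x = Sum.inr q → blk x = some q ∧ τ q ≤ x ∧ x < N) ∧
        ∀ e α α', (∀ q ∈ R e, α q = α' q) → C (fill L α) τ e = C (fill L α') τ e := by
  classical
  induction m with
  | zero =>
    intro E _ R
    refine ⟨0, fun _ => none, fun C hC => ⟨fun _ => Sum.inl (Classical.arbitrary A), fun _ => 0,
      fun q => q.elim0, fun q => q.elim0, fun _ q => q.elim0, fun e α α' _ => ?_⟩⟩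
    exact hC _ _ _ _ _ (by simp) (fun q => q.elim0)
  | succ m ih =>
    intro E _ R
    -- The colour of a first block is the whole function of the later letters, so `N₀` is
    -- independent of the later blocks. Parameters with `0 ∈ R e` are left out, as the first letter
    -- may matter for them.
    obtain ⟨N₀, h₀⟩ := exists_line A ({e // 0 ∉ R e} × (Fin m → A) → κ)
    obtain ⟨N₁, blk, h₁⟩ := ih (E × (Fin N₀ → A) × Fin N₀) (fun e => {q | q.succ ∈ R e.1})
    refine ⟨N₀ + N₁, fun x => if x < N₀ then some 0 else (blk (x - N₀)).map Fin.succ,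
      fun C hC => ?_⟩
    obtain ⟨L₁, τ₁, hτ₁, hL₁, hb₁, hi₁⟩ := h₁
      (fun u τ e => C (fun x => if h : x < N₀ then e.2.1 ⟨x, h⟩ else u (x - N₀))
        (Fin.cons (e.2.2 : ℕ) fun q => N₀ + τ q) e.1) (by
        intro u u' τ τ' e hu hτ
        apply hC
        · intro x hx
          by_cases h : x < N₀
          · simp [h]
          · simp only [h, dite_false]
            exact hu _ (by omega)
        · intro q hq
          refine Fin.cases ?_ ?_ q hq
          · simp
          · intro q hq
            simp [hτ q hq])
    -- The first position `p` is not known yet; the value `0` stands in for it, which is harmless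
    -- since the colour does not see it when `0 ∉ R e`.
    obtain ⟨L₀, p, hp, hL₀, hi₀⟩ := h₀
      (fun u e => C (fun x => if x < N₀ then u x else fill L₁ e.2 (x - N₀))
        (Fin.cons 0 fun q => N₀ + τ₁ q) e.1) (by
        intro u u' hu
        funext e
        apply hC
        · intro x hx
          by_cases h : x < N₀
          · simp [h, hu]
          · simp [h]
        · intros; rfl)
    have hpN : p < N₀ := (hL₀ p hp).2
    refine ⟨fun x => if x < N₀ then (L₀ x).elim (Sum.inr 0) Sum.inl
        else Sum.map id Fin.succ (L₁ (x - N₀)), Fin.cons p fun q => N₀ + τ₁ q, ?_, ?_, ?_, ?_⟩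
    · intro q q' hqq
      induction q using Fin.cases with
      | zero =>
        induction q' using Fin.cases with
        | zero => exact absurd hqq (lt_irrefl _)
        | succ q' => simp; omega
      | succ q =>
        induction q' using Fin.cases with
        | zero => exact absurd hqq (by simp)
        | succ q' => simpa using hτ₁ (Fin.succ_lt_succ_iff.1 hqq)
    · intro q
      induction q using Fin.cases with
      | zero => simp [hpN, hp]
      | succ q => simp [hL₁]
    · intro x q hx
      by_cases h : x < N₀
      · simp only [h, if_true] at hx ⊢
        cases hx0 : L₀ x with
        | none =>
          rw [hx0] at hx
          obtain rfl : 0 = q := by simpa using hx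
          have := hL₀ x hx0
          simp
          omega
        | some a => simp [hx0] at hx
      · simp only [h, if_false] at hx ⊢
        cases hx1 : L₁ (x - N₀) with
        | inl a => simp [hx1] at hx
        | inr q' =>
          rw [hx1] at hx
          obtain rfl : q'.succ = q := by simpa using hx
          have := hb₁ _ _ hx1
          refine ⟨by simp [this.1], ?_, by omega⟩
          simp only [Fin.cons_succ]
          omega
    · intro e α α' hα
      have key : ∀ β : Fin (m + 1) → A,
          C (fill (fun x => if x < N₀ then (L₀ x).elim (Sum.inr 0) Sum.inl
            else Sum.map id Fin.succ (L₁ (x - N₀))) β) (Fin.cons p fun q => N₀ + τ₁ q) e =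
          C (fun x => if x < N₀ then (L₀ x).getD (β 0) else fill L₁ (fun q => β q.succ) (x - N₀))
            (Fin.cons p fun q => N₀ + τ₁ q) e := by
        intro β
        congr 1
        funext x
        by_cases h : x < N₀
        · cases hx : L₀ x <;> simp [fill, h, hx]
        · cases hx : L₁ (x - N₀) <;> simp [fill, h, hx]
      rw [key, key]
      have h1 := hi₁ (e, fun x => (L₀ x).getD (α 0), ⟨p, hpN⟩) (fun q => α q.succ)
        (fun q => α' q.succ) (fun q hq => hα _ hq)
      simp only [dite_eq_ite] at h1
      rw [h1]
      by_cases h : (0 : Fin (m + 1)) ∈ R e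
      · rw [hα 0 h]
      · have h2 := congrFun (hi₀ (α 0) (α' 0)) (⟨e, h⟩, fun q => α' q.succ)
        have h3 : ∀ u, C u (Fin.cons p fun q => N₀ + τ₁ q) e =
            C u (Fin.cons 0 fun q => N₀ + τ₁ q) e := by
          intro u
          apply hC _ _ _ _ _ (fun _ _ => rfl)
          intro q hq
          induction q using Fin.cases with
          | zero => exact absurd hq h
          | succ q => simp
        rw [h3, h3]
        exact h2

/-- A Hales–Jewett theorem for words with consecutive blocks, one for each `q : Q`, where the
colouring may also depend on the first occurrences `τ q` of the variables with `q ∈ R e`. -/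
theorem exists_sequential (A Q E κ : Type) [Finite A] [Nonempty A] [LinearOrder Q] [Finite Q]
    [Finite E] [Finite κ] (R : E → Set Q) :
    ∃ (N : ℕ) (blk : ℕ → Option Q), ∀ C : (ℕ → A) → (Q → ℕ) → E → κ,
      (∀ u u' τ τ' e, (∀ x < N, u x = u' x) → (∀ q ∈ R e, τ q = τ' q) → C u τ e = C u' τ' e) →
      ∃ (L : ℕ → A ⊕ Q) (τ : Q → ℕ), StrictMono τ ∧ (∀ q, L (τ q) = Sum.inr q) ∧
        (∀ x q, L x = Sum.inr q → blk x = some q ∧ τ q ≤ x ∧ x < N) ∧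
        ∀ e α α', (∀ q ∈ R e, α q = α' q) → C (fill L α) τ e = C (fill L α') τ e := by
  have := Fintype.ofFinite Q
  let φ : Fin (Fintype.card Q) ≃o Q := Fintype.orderIsoFinOfCardEq Q rfl
  obtain ⟨N, blk, h⟩ := exists_sequential_fin A κ (Fintype.card Q) E (fun e => φ ⁻¹' R e)
  refine ⟨N, fun x => (blk x).map φ, fun C hC => ?_⟩
  obtain ⟨L, τ, hτ, hL, hb, hi⟩ := h (fun u τ e => C u (fun q => τ (φ.symm q)) e) (by
    intro u u' τ τ' e hu hτ
    exact hC _ _ _ _ _ hu fun q hq => hτ _ (by simpa using hq))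
  refine ⟨fun x => Sum.map id φ (L x), fun q => τ (φ.symm q), hτ.comp φ.symm.strictMono, ?_, ?_, ?_⟩
  · intro q
    simp [hL]
  · intro x q hx
    cases hx1 : L x with
    | inl a => simp [hx1] at hx
    | inr q' =>
      obtain rfl : φ q' = q := by simpa [hx1] using hx
      simpa using hb _ _ hx1
  · intro e α α' hα
    have key : ∀ β : Q → A, fill (fun x => Sum.map id φ (L x)) β = fill L (fun q => β (φ q)) := by
      intro β
      funext x
      cases hx : L x <;> simp [fill, hx]
    rw [key, key]
    exact hi e _ _ fun q hq => hα _ hq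

/-! ### Direction-preserving maps of trees. -/

theorem prefix_trichotomy {α : Type*} (s t : List α) :
    s <+: t ∨ t <+: s ∨ ∃ (p : List α) (i j : α) (u v : List α),
      i ≠ j ∧ s = p ++ i :: u ∧ t = p ++ j :: v := by
  classical
  induction s generalizing t with
  | nil => exact Or.inl List.nil_prefix
  | cons a s ih =>
    cases t with
    | nil => exact Or.inr (Or.inl List.nil_prefix)
    | cons c t =>
      by_cases h : a = c
      · subst h
        rcases ih t with h | h | ⟨p, i, j, u, v, hij, rfl, rfl⟩
        · exact Or.inl (by simpa using h)
        · exact Or.inr (Or.inl (by simpa using h))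
        · exact Or.inr (Or.inr ⟨a :: p, i, j, u, v, hij, rfl, rfl⟩)
      · exact Or.inr (Or.inr ⟨[], a, c, s, t, h, rfl, rfl⟩)

theorem exists_append_singleton_prefix {α : Type*} {s t : List α} (h : s <+: t) (hne : s ≠ t) :
    ∃ j, s ++ [j] <+: t := by
  obtain ⟨_ | ⟨j, u⟩, rfl⟩ := h
  · simp at hne
  · exact ⟨j, u, by simp⟩

/-- Up to length `K`, the map `g` sends immediate successors in direction `j` to proper extensions
in direction `j`. -/
def IsTreeMap {b : ℕ} (K : ℕ) (g : List (Fin b) → List (Fin b)) : Prop :=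
  ∀ s j, s.length < K → g s ++ [j] <+: g (s ++ [j])

namespace IsTreeMap

variable {b K : ℕ} {g : List (Fin b) → List (Fin b)} {s t v : List (Fin b)}

theorem prefix_map (hg : IsTreeMap K g) (h : s <+: t) (ht : t.length ≤ K) : g s <+: g t := by
  obtain ⟨u, rfl⟩ := h
  induction u using List.reverseRecOn with
  | nil => simp
  | append_singleton u j ih =>
    rw [← List.append_assoc] at ht ⊢
    simp only [List.length_append, List.length_singleton] at ht ih
    refine (ih (by omega)).trans ((List.prefix_append _ [j]).trans (hg _ j ?_))
    simp only [List.length_append]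
    omega

theorem append_prefix_map (hg : IsTreeMap K g) {j : Fin b} (h : s ++ [j] <+: t)
    (ht : t.length ≤ K) : g s ++ [j] <+: g t := by
  refine (hg s j ?_).trans (hg.prefix_map h ht)
  have := h.length_le
  simp only [List.length_append, List.length_singleton] at this
  omega

/-- If `s` and `t` split after `p` in directions `i ≠ j`, then `v` would extend both `g p ++ [i]`
and `g p ++ [j]`. This is what makes nodes recoverable from their images. -/
theorem comparable (hg : IsTreeMap K g) (hs : s.length ≤ K) (ht : t.length ≤ K)
    (hsv : g s <+: v) (htv : g t <+: v) : s <+: t ∨ t <+: s := by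
  rcases prefix_trichotomy s t with h | h | ⟨p, i, j, u, w, hij, rfl, rfl⟩
  · exact Or.inl h
  · exact Or.inr h
  · exfalso
    have h1 := (hg.append_prefix_map (s := p) (j := i) ⟨u, by simp⟩ hs).trans hsv
    have h2 := (hg.append_prefix_map (s := p) (j := j) ⟨w, by simp⟩ ht).trans htv
    have := (List.prefix_of_prefix_length_le h1 h2 (by simp)).eq_of_length (by simp)
    simp at this
    exact hij this

theorem eq_of_prefix (hg : IsTreeMap K g) (hs : s.length ≤ K) (hst : s.length = t.length)
    (hsv : g s <+: v) (htv : g t <+: v) : s = t := by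
  rcases hg.comparable hs (hst ▸ hs) hsv htv with h | h
  · exact h.eq_of_length hst
  · exact (h.eq_of_length hst.symm).symm

theorem length_lt (hg : IsTreeMap K g) (h : s <+: t) (hne : s ≠ t) (ht : t.length ≤ K) :
    (g s).length < (g t).length := by
  obtain ⟨j, hj⟩ := exists_append_singleton_prefix h hne
  have := (hg.append_prefix_map hj ht).length_le
  simp only [List.length_append, List.length_singleton] at this
  omega

theorem prefix_of_map (hg : IsTreeMap K g) (hs : s.length ≤ K) (ht : t.length ≤ K)
    (h : g s <+: g t) : s <+: t := by
  rcases hg.comparable hs ht h List.prefix_rfl with h' | h'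
  · exact h'
  · by_cases hne : t = s
    · exact hne ▸ List.prefix_rfl
    · have := hg.length_lt h' hne hs
      have := h.length_le
      omega

theorem lexLE (hg : IsTreeMap K g) (hs : s.length ≤ K) (ht : t.length ≤ K)
    (h : LexLE s t) : LexLE (g s) (g t) := by
  rcases h with h | ⟨p, i, j, u, v, hij, rfl, rfl⟩
  · exact Or.inl (hg.prefix_map h ht)
  · obtain ⟨u', hu⟩ := hg.append_prefix_map (s := p) (j := i) ⟨u, by simp⟩ hs
    obtain ⟨v', hv⟩ := hg.append_prefix_map (s := p) (j := j) ⟨v, by simp⟩ ht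
    exact Or.inr ⟨g p, i, j, u', v', hij, by simp [← hu], by simp [← hv]⟩

end IsTreeMap

/-! ### Embeddings and their composition. -/

/-- An embedding of `d` trees of height `K` into `d` trees of height `n`, together with variable
words whose variables are indexed by the nodes of the smaller trees. -/
structure Emb (d b K n : ℕ) (Λ : Type) where
  e : Fin d → List (Fin b) → List (Fin b)
  f : Fin d → List (Fin b) → Λ ⊕ List (Fin b)
  isTreeMap : ∀ i, IsTreeMap K (e i)
  length_eq : ∀ i s, s.length = K → (e i s).length = n
  lt : ∀ i j s t, s.length < t.length → t.length ≤ K → (e i s).length < (e j t).length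
  le : ∀ i j s t, s.length = t.length → t.length ≤ K → (i < j ∨ i = j ∧ LexLE s t) →
    (e i s).length ≤ (e j t).length
  f_e : ∀ i s, s.length < K → f i (e i s) = Sum.inr s
  e_prefix : ∀ i v s, v.length < n → f i v = Sum.inr s → s.length < K ∧ e i s <+: v

namespace Emb

variable {d b K n m : ℕ} {Λ : Type}

theorem length_lt [NeZero b] (Φ : Emb d b K n Λ) (i : Fin d) {s : List (Fin b)}
    (hs : s.length < K) : (Φ.e i s).length < n := by
  have := Φ.lt i i s (List.replicate K 0) (by simpa using hs) (by simp)
  rwa [Φ.length_eq i (List.replicate K 0) (by simp)] at this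

theorem length_le [NeZero b] (Φ : Emb d b K n Λ) (i : Fin d) {s : List (Fin b)}
    (hs : s.length ≤ K) : (Φ.e i s).length ≤ n := by
  rcases hs.lt_or_eq with h | h
  · exact (Φ.length_lt i h).le
  · exact (Φ.length_eq i s h).le

/-- The word obtained by substituting `a i s` for the variables `s` of the `i`-th word. -/
def word (Φ : Emb d b K n Λ) (a : Fin d → List (Fin b) → Λ) (i : Fin d) (v : List (Fin b)) : Λ :=
  Sum.elim id (a i) (Φ.f i v)

/-- The colouring of the smaller trees induced by a colouring of the larger ones. -/
def pull {κ : Type*} (Φ : Emb d b K n Λ)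
    (c : (Fin d → List (Fin b) → Λ) → (Fin d → List (Fin b)) → κ)
    (a : Fin d → List (Fin b) → Λ) (z : Fin d → List (Fin b)) : κ :=
  c (Φ.word a) fun i => Φ.e i (z i)

/-- Composition of embeddings. -/
def comp [NeZero b] (Φ : Emb d b K n Λ) (Ψ : Emb d b m K Λ) : Emb d b m n Λ where
  e i s := Φ.e i (Ψ.e i s)
  f i v := Sum.elim Sum.inl (Ψ.f i) (Φ.f i v)
  isTreeMap i s j hs := by
    refine (Φ.isTreeMap i).append_prefix_map (Ψ.isTreeMap i s j hs) (Ψ.length_le i ?_)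
    simpa using hs
  length_eq i s hs := Φ.length_eq i _ (Ψ.length_eq i s hs)
  lt i j s t hst ht := Φ.lt i j _ _ (Ψ.lt i j s t hst ht) (Ψ.length_le j ht)
  le i j s t hst ht h := by
    -- Nodes of one level may land on different levels; the order condition on `Φ` is needed only
    -- when they land on the same one.
    rcases (Ψ.le i j s t hst ht h).lt_or_eq with h' | h'
    · exact (Φ.lt i j _ _ h' (Ψ.length_le j ht)).le
    · refine Φ.le i j _ _ h' (Ψ.length_le j ht) (h.imp_right fun hij => ⟨hij.1, ?_⟩)
      obtain ⟨rfl, hij⟩ := hij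
      exact (Ψ.isTreeMap i).lexLE (hst ▸ ht) ht hij
  f_e i s hs := by
    rw [Φ.f_e i _ (Ψ.length_lt i hs)]
    exact Ψ.f_e i s hs
  e_prefix i v s hv h := by
    cases hx : Φ.f i v with
    | inl x => simp [hx] at h
    | inr t =>
      have h1 := Φ.e_prefix i v t hv hx
      rw [hx] at h
      have h2 := Ψ.e_prefix i t s h1.1 h
      exact ⟨h2.1, ((Φ.isTreeMap i).prefix_map h2.2 h1.1.le).trans h1.2⟩

theorem pull_comp [NeZero b] {κ : Type*} (Φ : Emb d b K n Λ) (Ψ : Emb d b m K Λ)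
    (c : (Fin d → List (Fin b) → Λ) → (Fin d → List (Fin b)) → κ) :
    (Φ.comp Ψ).pull c = Ψ.pull (Φ.pull c) := by
  funext a z
  simp only [pull]
  congr 1
  funext i v
  cases hx : Φ.f i v <;> simp [word, comp, hx]

/-- The embedding which is the identity except that the leaves are prolonged by zeros. -/
def pad [NeZero b] [Inhabited Λ] (h : K ≤ n) : Emb d b K n Λ where
  e _ s := if s.length < K then s else s ++ List.replicate (n - K) 0
  f _ v := if v.length < K then Sum.inr v else Sum.inl default
  isTreeMap i s j hs := by
    simp only [hs, if_true]
    split_ifs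
    · exact List.prefix_rfl
    · exact List.prefix_append _ _
  length_eq i s hs := by simp [hs, h]
  lt i j s t hst ht := by
    have : s.length < K := by omega
    simp only [this, if_true]
    split_ifs
    · exact hst
    · simp; omega
  le i j s t hst ht _ := by
    rw [hst]
    split_ifs <;> simp [hst]
  f_e i s hs := by simp [hs]
  e_prefix i v s hv h := by
    split_ifs at h with h'
    · obtain rfl : v = s := by simpa using h
      simp [h']

end Emb

/-! ### Removing the letters off the given sequences. -/

/-- The colour of `(a, z)` depends only on `z` and on those letters `a i s`, `|s| < K`, for which
`|s| < M` or `s` is an initial segment of `z i`. -/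
def Insens {d b : ℕ} {Λ : Type} {κ : Type*} (K M : ℕ)
    (c : (Fin d → List (Fin b) → Λ) → (Fin d → List (Fin b)) → κ) : Prop :=
  ∀ a a' z, (∀ i, (z i).length ≤ K) →
    (∀ i s, s.length < K → s.length < M ∨ s <+: z i → a i s = a' i s) → c a z = c a' z

/-- Every variable occurring inside the large tree is a node of length less than `K`, so a colouring
that reads no letters outside its tree induces one with the same property. -/
theorem Insens.pull {d b K n : ℕ} [NeZero b] {Λ : Type} {κ : Type*}
    {c : (Fin d → List (Fin b) → Λ) → (Fin d → List (Fin b)) → κ} (hc : Insens n n c)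
    (Φ : Emb d b K n Λ) : Insens K K (Φ.pull c) := by
  intro a a' z hz h
  refine hc _ _ _ (fun i => Φ.length_le i (hz i)) fun i v hv _ => ?_
  unfold Emb.word
  cases hx : Φ.f i v with
  | inl x => rfl
  | inr s =>
    have := (Φ.e_prefix i v s hv hx).1
    exact h i s this (Or.inl this)

theorem exists_eq_append_cons {b M : ℕ} {s : List (Fin b)} (h : M < s.length) :
    ∃ y j t, y.length = M ∧ s = y ++ j :: t := by
  refine ⟨s.take M, s[M], s.drop (M + 1), by simp; omega, ?_⟩
  simp

section StepMap

variable {b : ℕ} [NeZero b]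

/-- The map which replaces the `M`-th level by `N` levels; the node `y` of length `M` is moved
`τ y` levels up along a sequence of zeros. -/
def stepMap (M N : ℕ) (τ : List (Fin b) → ℕ) (s : List (Fin b)) : List (Fin b) :=
  if s.length ≤ M then s ++ List.replicate (τ s) 0
  else s.take M ++ (List.replicate (τ (s.take M)) 0 ++ ((s.drop M).take 1 ++
    (List.replicate (N - 1 - τ (s.take M)) 0 ++ s.drop (M + 1))))

variable {M N : ℕ} {τ : List (Fin b) → ℕ}

theorem stepMap_of_le {s : List (Fin b)} (h : s.length ≤ M) :
    stepMap M N τ s = s ++ List.replicate (τ s) 0 := if_pos h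

theorem stepMap_append_cons {y t : List (Fin b)} {j : Fin b} (h : y.length = M) :
    stepMap M N τ (y ++ j :: t) = y ++ (List.replicate (τ y) 0 ++ (j ::
      (List.replicate (N - 1 - τ y) 0 ++ t))) := by
  subst h
  simp [stepMap, List.drop_append]

/-- The `N - 1 - τ y` zeros after the chosen direction compensate for the `τ y` zeros before it, so
beyond level `M` the length does not depend on `τ`. -/
theorem length_stepMap (h0 : ∀ y, y.length ≠ M → τ y = 0) (hN : ∀ y, y.length = M → τ y < N)
    (s : List (Fin b)) : (stepMap M N τ s).length =
      if s.length < M then s.length else if s.length = M then M + τ s else s.length + N - 1 := by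
  rcases lt_trichotomy s.length M with h | h | h
  · simp [stepMap_of_le h.le, h, h0 s h.ne]
  · simp [stepMap_of_le h.le, h]
  · obtain ⟨y, j, t, hy, rfl⟩ := exists_eq_append_cons h
    have := hN y hy
    rw [if_neg h.not_gt, if_neg h.ne', stepMap_append_cons hy]
    simp only [List.length_append, List.length_cons, List.length_replicate]
    omega

theorem isTreeMap_stepMap (h0 : ∀ y, y.length ≠ M → τ y = 0) (K : ℕ) :
    IsTreeMap K (stepMap M N τ) := by
  intro s j _
  rcases lt_trichotomy s.length M with h | h | h
  · rw [stepMap_of_le h.le, h0 s h.ne, stepMap_of_le (by simpa using h)]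
    simp
  · rw [stepMap_of_le h.le, stepMap_append_cons h]
    exact ⟨List.replicate (N - 1 - τ s) 0 ++ [], by simp⟩
  · obtain ⟨y, i, t, hy, rfl⟩ := exists_eq_append_cons h
    rw [List.append_assoc, List.cons_append, stepMap_append_cons hy, stepMap_append_cons hy]
    simp

end StepMap

theorem append_cons_lt {b : ℕ} (p : List (Fin b)) {i j : Fin b} (hij : i < j)
    (u v : List (Fin b)) : p ++ i :: u < p ++ j :: v := by
  induction p with
  | nil => exact List.Lex.rel hij
  | cons a p ih => exact List.Lex.cons ih

theorem LexLE.le_of_length_eq {b : ℕ} {s t : List (Fin b)} (h : LexLE s t)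
    (hst : s.length = t.length) : s ≤ t := by
  rcases h with h | ⟨p, i, j, u, v, hij, rfl, rfl⟩
  · exact (h.eq_of_length hst).le
  · exact (append_cons_lt p hij u v).le

instance (b n : ℕ) : Finite (Node b n) := by
  refine Set.Finite.to_subtype ?_
  exact List.finite_length_lt (Fin b) n

instance (b n : ℕ) : Finite (Leaf b n) := by
  refine Set.Finite.to_subtype ?_
  exact List.finite_length_eq (Fin b) n

section StepEmb

variable {d b M N P : ℕ} [NeZero b] {Λ : Type} [Inhabited Λ]

/-- The first position of the variable of the node `y` of the `i`-th tree, or `0` if `y` does not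
belong to the `M`-th level. -/
def offset (τ : Fin d ×ₗ Leaf b M → ℕ) (i : Fin d) (y : List (Fin b)) : ℕ :=
  if h : y.length = M then τ (toLex (i, ⟨y, h⟩)) else 0

/-- The node `v` lies on the chain of zeros above a node `y` of level `M`, in the block reserved
for `y`. -/
def OnChain (blk : ℕ → Option (Fin d ×ₗ Leaf b M)) (i : Fin d) (v : List (Fin b)) : Prop :=
  v = v.take M ++ List.replicate (v.length - M) 0 ∧
    ∃ y : Leaf b M, y.1 = v.take M ∧ blk (v.length - M) = some (toLex (i, y))

open Classical in
/-- The embedding which replaces the `M`-th level by the blocks of the word `L`. -/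
noncomputable def stepEmb (P : ℕ) (L : ℕ → Λ ⊕ (Fin d ×ₗ Leaf b M)) (τ : Fin d ×ₗ Leaf b M → ℕ)
    (blk : ℕ → Option (Fin d ×ₗ Leaf b M)) (hτ : StrictMono τ) (hτN : ∀ q, τ q < N)
    (hL : ∀ q, L (τ q) = Sum.inr q)
    (hb : ∀ x q, L x = Sum.inr q → blk x = some q ∧ τ q ≤ x ∧ x < N) :
    Emb d b (M + 1 + P) (M + N + P) Λ :=
  have h0 : ∀ i y, y.length ≠ M → offset τ i y = 0 := fun i y h => dif_neg h
  have hN : ∀ i y, y.length = M → offset τ i y < N := fun i y h => by simp [offset, h, hτN]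
  { e := fun i => stepMap M N (offset τ i)
    f := fun i v =>
      if v.length < M then Sum.inr v
      else if v.length < M + N then
        -- A single word `L` serves all nodes of all trees: position `x` is used only above the node
        -- `blk x`, along zeros. Each variable therefore occurs only above its own node.
        if OnChain blk i v then Sum.map id (fun _ => v.take M) (L (v.length - M))
        else Sum.inl default
      else if h : ∃ s, s.length < M + 1 + P ∧ stepMap M N (offset τ i) s = v then Sum.inr h.choose
      else Sum.inl default
    isTreeMap := fun i => isTreeMap_stepMap (h0 i) _
    length_eq := fun i s hs => by
      rw [length_stepMap (h0 i) (hN i)]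
      split_ifs <;> omega
    lt := fun i j s t hst ht => by
      have := hN i s
      have := hN j t
      rw [length_stepMap (h0 i) (hN i), length_stepMap (h0 j) (hN j)]
      split_ifs <;> omega
    le := fun i j s t hst ht h => by
      rw [length_stepMap (h0 i) (hN i), length_stepMap (h0 j) (hN j), hst]
      split_ifs with h1 h2
      · exact le_rfl
      · have h2' : s.length = M := hst.trans h2
        simp only [offset, h2, h2', dite_true, add_le_add_iff_left]
        apply hτ.monotone
        rw [Prod.Lex.toLex_le_toLex]
        exact h.imp_right fun h => ⟨h.1, h.2.le_of_length_eq hst⟩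
      · exact le_rfl
    f_e := fun i s hs => by
      have hl := length_stepMap (h0 i) (hN i) s
      rcases lt_trichotomy s.length M with h | h | h
      · rw [stepMap_of_le h.le, h0 i s h.ne]
        simp [h]
      · rw [if_neg (by omega), if_pos h] at hl
        have h1 := hN i s h
        rw [if_neg (by omega), if_pos (by omega)]
        have h2 : (stepMap M N (offset τ i) s).take M = s := by
          rw [stepMap_of_le h.le]
          exact List.take_left' h
        have h3 : (stepMap M N (offset τ i) s).length - M = τ (toLex (i, ⟨s, h⟩)) := by
          rw [hl]
          simp [offset, h]
        rw [if_pos, h2, h3, hL]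
        · rfl
        · refine ⟨?_, ⟨s, h⟩, h2.symm, ?_⟩
          · rw [h2, hl, stepMap_of_le h.le]
            simp
          · rw [h3]
            exact (hb _ _ (hL _)).1
      · rw [if_neg (by omega), if_neg (by omega)] at hl
        rw [if_neg (by omega), if_neg (by omega)]
        have hex : ∃ s', s'.length < M + 1 + P ∧
            stepMap M N (offset τ i) s' = stepMap M N (offset τ i) s := ⟨s, hs, rfl⟩
        rw [dif_pos hex]
        have h1 := hex.choose_spec
        congr 1
        have hT := isTreeMap_stepMap (N := N) (h0 i) (M + 1 + P)
        exact (hT.prefix_of_map h1.1.le hs.le (by rw [h1.2])).eq_of_length_le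
          (hT.prefix_of_map hs.le h1.1.le (by rw [h1.2])).length_le
    e_prefix := fun i v s hv h => by
      split_ifs at h with h1 h2 h3 h4
      · obtain rfl : v = s := by simpa using h
        refine ⟨by omega, ?_⟩
        rw [stepMap_of_le h1.le, h0 i v h1.ne]
        simp
      · obtain ⟨h3, y, hy, hyb⟩ := h3
        cases hx : L (v.length - M) with
        | inl x => simp [hx] at h
        | inr q =>
          obtain rfl : v.take M = s := by simpa [hx] using h
          have hq := hb _ _ hx
          obtain rfl : toLex (i, y) = q := by
            have := hyb.symm.trans hq.1
            simpa using this
          have hl : (v.take M).length = M := by simp; omega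
          refine ⟨by omega, ?_⟩
          rw [stepMap_of_le hl.le]
          conv_rhs => rw [h3]
          have ho : offset τ i (v.take M) = τ (toLex (i, y)) := by
            rw [offset, dif_pos hl]
            congr
            exact hy.symm
          rw [ho, List.prefix_append_right_inj]
          exact ⟨List.replicate (v.length - M - τ (toLex (i, y))) 0, by
            rw [List.replicate_append_replicate]; congr 1; omega⟩
      · obtain rfl : h4.choose = s := by simpa using h
        exact ⟨h4.choose_spec.1, by rw [h4.choose_spec.2]⟩ }

end StepEmb

section WordStepEmb

variable {d b : ℕ} [NeZero b] {Λ : Type} [Inhabited Λ]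

/-- Past the block every initial segment of the image of `z` is itself the image of an initial
segment of `z`, shorter by `N - 1`. Its letter is thus a variable of the small tree. -/
theorem word_stepEmb_of_prefix {M N P : ℕ} {L : ℕ → Λ ⊕ (Fin d ×ₗ Leaf b M)}
    {τ : Fin d ×ₗ Leaf b M → ℕ} {blk : ℕ → Option (Fin d ×ₗ Leaf b M)} (hτ : StrictMono τ)
    (hτN : ∀ q, τ q < N) (hL : ∀ q, L (τ q) = Sum.inr q)
    (hb : ∀ x q, L x = Sum.inr q → blk x = some q ∧ τ q ≤ x ∧ x < N)
    (a : Fin d → List (Fin b) → Λ) {i : Fin d} {v z : List (Fin b)} (hz : z.length ≤ M + 1 + P)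
    (hv : M + N ≤ v.length) (hvl : v.length < M + N + P)
    (h : v <+: (stepEmb P L τ blk hτ hτN hL hb).e i z) :
    (stepEmb P L τ blk hτ hτN hL hb).word a i v = a i (z.take (v.length + 1 - N)) := by
  have h0 : ∀ y : List (Fin b), y.length ≠ M → offset τ i y = 0 := fun y h => dif_neg h
  have hN : ∀ y : List (Fin b), y.length = M → offset τ i y < N := fun y h => by
    simp [offset, h, hτN]
  have hl : ((stepEmb P L τ blk hτ hτN hL hb).e i z).length = _ := length_stepMap h0 hN z
  have hvle := h.length_le
  rw [hl] at hvle
  have hMz : M < z.length := by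
    have := hN z
    split_ifs at hvle <;> omega
  rw [if_neg (by omega), if_neg (by omega)] at hvle
  set Φ := stepEmb P L τ blk hτ hτN hL hb with hΦ
  have hlt : (z.take (v.length + 1 - N)).length = v.length + 1 - N := by simp; omega
  have hN1 : 1 ≤ N := by
    have := hN (z.take M) (by simp; omega)
    omega
  have hlt' : (Φ.e i (z.take (v.length + 1 - N))).length = v.length := by
    have : (Φ.e i (z.take (v.length + 1 - N))).length = _ := length_stepMap h0 hN _
    rw [this, hlt, if_neg (by omega), if_neg (by omega)]
    omega
  have hpre : Φ.e i (z.take (v.length + 1 - N)) <+: Φ.e i z :=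
    (Φ.isTreeMap i).prefix_map (List.take_prefix _ _) hz
  have hev : Φ.e i (z.take (v.length + 1 - N)) = v :=
    (List.prefix_of_prefix_length_le hpre h hlt'.le).eq_of_length hlt'
  have := Φ.f_e i (z.take (v.length + 1 - N)) (by omega)
  rw [hev] at this
  simp [Emb.word, this]

theorem word_stepEmb_of_lt {M N P : ℕ} {L : ℕ → Λ ⊕ (Fin d ×ₗ Leaf b M)}
    {τ : Fin d ×ₗ Leaf b M → ℕ} {blk : ℕ → Option (Fin d ×ₗ Leaf b M)} (hτ : StrictMono τ)
    (hτN : ∀ q, τ q < N) (hL : ∀ q, L (τ q) = Sum.inr q)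
    (hb : ∀ x q, L x = Sum.inr q → blk x = some q ∧ τ q ≤ x ∧ x < N)
    (a : Fin d → List (Fin b) → Λ) {i : Fin d} {v : List (Fin b)} (hv : v.length < M) :
    (stepEmb P L τ blk hτ hτN hL hb).word a i v = a i v := by
  simp [Emb.word, stepEmb, hv]

open Classical in
-- A variable of `L` occurs only in its own block, so on the chain of `y` the only possible variable
-- is that of `y`, and the substitution agrees with filling `L`.
theorem word_stepEmb_of_mem_block {M N P : ℕ} {L : ℕ → Λ ⊕ (Fin d ×ₗ Leaf b M)}
    {τ : Fin d ×ₗ Leaf b M → ℕ} {blk : ℕ → Option (Fin d ×ₗ Leaf b M)} (hτ : StrictMono τ)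
    (hτN : ∀ q, τ q < N) (hL : ∀ q, L (τ q) = Sum.inr q)
    (hb : ∀ x q, L x = Sum.inr q → blk x = some q ∧ τ q ≤ x ∧ x < N)
    (a : Fin d → List (Fin b) → Λ) {i : Fin d} {v : List (Fin b)} (hv : M ≤ v.length)
    (hvN : v.length < M + N) :
    (stepEmb P L τ blk hτ hτN hL hb).word a i v = if OnChain blk i v then
      fill L (fun q => a (ofLex q).1 (ofLex q).2.1) (v.length - M) else default := by
  have h1 : ¬ v.length < M := by omega
  by_cases hc : OnChain blk i v
  · cases hx : L (v.length - M) with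
    | inl x => simp [Emb.word, stepEmb, h1, hvN, hc, fill, hx]
    | inr q =>
      obtain ⟨-, y, hy, hyb⟩ := id hc
      obtain rfl : toLex (i, y) = q := by
        have := hyb.symm.trans (hb _ _ hx).1
        simpa using this
      simp [Emb.word, stepEmb, h1, hvN, hc, fill, hx, hy]
  · simp [Emb.word, stepEmb, h1, hvN, hc]

end WordStepEmb

/-- One level can be replaced by a block of levels in such a way that the colour becomes
insensitive to the letters on this level off the given nodes. -/
theorem exists_step {Λ : Type} [Inhabited Λ] [Finite Λ] (κ : Type) [Finite κ]
    (d b : ℕ) [NeZero b] (M P : ℕ) :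
    ∃ N : ℕ, ∀ c : (Fin d → List (Fin b) → Λ) → (Fin d → List (Fin b)) → κ,
      Insens (M + N + P) (M + N) c →
      ∃ Φ : Emb d b (M + 1 + P) (M + N + P) Λ, Insens (M + 1 + P) M (Φ.pull c) := by
  classical
  let K := M + 1 + P
  -- The parameter consists of `z` and the letters of the small trees: a finite set known before
  -- `N`.
  let E := (Fin d → Node b (K + 1)) × (Fin d → Node b K → Λ)
  let R : E → Set (Fin d ×ₗ Leaf b M) := fun e => {q | (ofLex q).2.1 <+: (e.1 (ofLex q).1).1}
  have : Finite (Fin d ×ₗ Leaf b M) := inferInstanceAs (Finite (Fin d × Leaf b M))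
  obtain ⟨N, blk, h⟩ := exists_sequential Λ (Fin d ×ₗ Leaf b M) E κ R
  refine ⟨N, fun c hc => ?_⟩
  let ext : (Fin d → Node b K → Λ) → Fin d → List (Fin b) → Λ := fun a i s =>
    if h : s.length < K then a i ⟨s, h⟩ else default
  -- This is the large word as far as the colour can see it. Above the block only initial segments
  -- of the image of `z` count, so the letter can be read from `z` and the length alone; in
  -- particular `W` does not involve `τ`.
  let W : (ℕ → Λ) → E → Fin d → List (Fin b) → Λ := fun u e i v =>
    if v.length < M then ext e.2 i v
    else if v.length < M + N then if OnChain blk i v then u (v.length - M) else default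
    else ext e.2 i ((e.1 i).1.take (v.length + 1 - N))
  obtain ⟨L, τ, hτ, hL, hb, hi⟩ := h
    (fun u τ e => c (W u e) fun i => stepMap M N (offset τ i) (e.1 i).1) (by
      intro u u' τ τ' e hu hτ
      congr 1
      · funext i v
        by_cases h1 : v.length < M
        · simp [W, h1]
        by_cases h2 : v.length < M + N
        · simp [W, h1, h2, hu (v.length - M) (by omega)]
        · simp [W, h1, h2]
      · funext i
        have ho : ∀ y, y <+: (e.1 i).1 → offset τ i y = offset τ' i y := by
          intro y hy
          simp only [offset]
          split_ifs with hl
          · exact hτ _ hy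
          · rfl
        simp only [stepMap]
        rw [ho _ List.prefix_rfl, ho _ (List.take_prefix _ _)])
  have hτN : ∀ q, τ q < N := fun q => (hb _ _ (hL q)).2.2
  let Φ := stepEmb P L τ blk hτ hτN hL hb
  refine ⟨Φ, ?_⟩
  intro a a' z hz haa
  let e : E := (fun i => ⟨z i, Nat.lt_succ_of_le (hz i)⟩, fun i s => a i s.1)
  have key : ∀ a'' : Fin d → List (Fin b) → Λ,
      (∀ i s, s.length < K → s.length < M ∨ s <+: z i → a i s = a'' i s) → Φ.pull c a'' z =
      c (W (fill L (fun q => a'' (ofLex q).1 (ofLex q).2.1)) e)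
        fun i => stepMap M N (offset τ i) (e.1 i).1 := by
    intro a'' ha
    refine hc _ _ _ (fun i => Φ.length_le i (hz i)) fun i v hv hvp => ?_
    by_cases h1 : v.length < M
    · rw [word_stepEmb_of_lt hτ hτN hL hb a'' h1]
      have h2 : v.length < K := by simp only [K]; omega
      simp [W, h1, ext, h2, e, ha i v h2 (Or.inl h1)]
    by_cases h2 : v.length < M + N
    · rw [word_stepEmb_of_mem_block hτ hτN hL hb a'' (by omega) h2]
      simp [W, h1, h2]
    · have h3 := hvp.resolve_left h2
      rw [word_stepEmb_of_prefix hτ hτN hL hb a'' (hz i) (by omega) hv h3]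
      have h4 : ((z i).take (v.length + 1 - N)).length < K := by
        simp only [K, List.length_take]; omega
      have h5 := ha i _ h4 (Or.inr (List.take_prefix _ _))
      simp only [W, h1, h2, if_false, ext, e, h4, dite_true]
      exact h5.symm
  -- Both colours are expressed with the same parameter `e`, built from `a`; only the letters of
  -- level `M` still differ.
  rw [key a (fun _ _ _ _ => rfl), key a' haa]
  apply hi
  intro q hq
  refine haa _ _ ?_ (Or.inr hq)
  have := (ofLex q).2.2
  omega

/-- After passing to an embedding of large height, the colour is insensitive to the letters which
lie on levels at least `M` and off the given nodes. -/
theorem exists_insens {Λ : Type} [Inhabited Λ] [Finite Λ] (κ : Type) [Finite κ]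
    (d b : ℕ) [NeZero b] (P : ℕ) : ∀ M : ℕ, ∃ n₀ : ℕ, ∀ n, n₀ ≤ n →
      ∀ c : (Fin d → List (Fin b) → Λ) → (Fin d → List (Fin b)) → κ,
      Insens n n c → ∃ Φ : Emb d b (M + P) n Λ, Insens (M + P) M (Φ.pull c) := by
  induction P with
  | zero =>
    intro M
    exact ⟨M, fun n hn c hc => ⟨Emb.pad hn, hc.pull _⟩⟩
  | succ P ih =>
    intro M
    -- The block length `N` for level `M` is fixed first, so that the top `P` levels can be treated
    -- over a base of `M + N` levels before level `M` is.
    obtain ⟨N, hN⟩ := exists_step (Λ := Λ) κ d b M P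
    obtain ⟨n₀, h₀⟩ := ih (M + N)
    refine ⟨n₀, fun n hn c hc => ?_⟩
    obtain ⟨Φ, hΦ⟩ := h₀ n hn c hc
    obtain ⟨Ψ, hΨ⟩ := hN _ hΦ
    rw [← Emb.pull_comp] at hΨ
    rw [show M + (P + 1) = M + 1 + P by omega]
    exact ⟨_, hΨ⟩

/-! ### Letters and directions along the paths. -/

/-- The sequence `(g 0, …, g (n - 1))`. -/
def pathOf {α : Type*} (g : ℕ → α) (n : ℕ) : List α := (List.range n).map g

section pathOf

variable {α : Type*} {g g' : ℕ → α} {n n' : ℕ}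

@[simp] theorem length_pathOf : (pathOf g n).length = n := by simp [pathOf]

theorem pathOf_congr (h : ∀ l < n, g l = g' l) : pathOf g n = pathOf g' n :=
  List.map_congr_left fun l hl => h l (List.mem_range.1 hl)

theorem pathOf_succ : pathOf g (n + 1) = pathOf g n ++ [g n] := by
  simp [pathOf, List.range_succ]

theorem pathOf_prefix (h : n ≤ n') : pathOf g n <+: pathOf g n' := by
  obtain ⟨m, rfl⟩ := Nat.exists_eq_add_of_le h
  induction m with
  | zero => exact List.prefix_rfl
  | succ m ih =>
    rw [← Nat.add_assoc, pathOf_succ]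
    exact (ih (by omega)).trans (List.prefix_append _ _)

end pathOf

section GoodEmb

variable {d b k N : ℕ} {Λ : Type}

open Classical in
/-- The variable `s` with `|s| = m` and `g s` an initial segment of `v`, if it exists. -/
noncomputable def varAt [Inhabited Λ] (g : List (Fin b) → List (Fin b)) (m : ℕ)
    (v : List (Fin b)) : Λ ⊕ List (Fin b) :=
  if h : ∃ s, s.length = m ∧ g s <+: v then Sum.inr h.choose else Sum.inl default

theorem varAt_eq [Inhabited Λ] {g : List (Fin b) → List (Fin b)} (hg : IsTreeMap k g)
    {s v : List (Fin b)} (hs : s.length ≤ k) (h : g s <+: v) :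
    (varAt g s.length v : Λ ⊕ List (Fin b)) = Sum.inr s := by
  have hex : ∃ t, t.length = s.length ∧ g t <+: v := ⟨s, rfl, h⟩
  rw [varAt, dif_pos hex, hg.eq_of_prefix (by rw [hex.choose_spec.1]; exact hs)
    hex.choose_spec.1 hex.choose_spec.2 h]

theorem of_varAt_eq [Inhabited Λ] {g : List (Fin b) → List (Fin b)} {m : ℕ} {s v : List (Fin b)}
    (h : (varAt g m v : Λ ⊕ List (Fin b)) = Sum.inr s) : s.length = m ∧ g s <+: v := by
  unfold varAt at h
  split_ifs at h with h2
  obtain rfl : h2.choose = s := by simpa using h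
  exact h2.choose_spec

/-- The position `l` lies in a block reserved for the `i`-th tree. -/
def InBlock (blk : ℕ → Option (Fin k ×ₗ Fin d)) (i : Fin d) (l : ℕ) : Prop :=
  ∃ m, blk l = some (toLex (m, i))

/-- The length of the nodes of height `m` in the `i`-th tree. -/
def nodeLength (N : ℕ) (τ : Fin k ×ₗ Fin d → ℕ) (i : Fin d) (m : ℕ) : ℕ :=
  if h : m < k then τ (toLex (⟨m, h⟩, i)) else N

variable {L : ℕ → (Λ × Fin b) ⊕ (Fin k ×ₗ Fin d)} {τ : Fin k ×ₗ Fin d → ℕ}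
  {blk : ℕ → Option (Fin k ×ₗ Fin d)}

/-- The variable `(m', i)` does not occur before `τ (m', i)`, the common length of the nodes of
height `m'` in tree `i`, and these lengths increase with the height. So a path to a node of height
`m` meets only variables of smaller height before its end. -/
theorem var_lt (hτ : StrictMono τ)
    (hb : ∀ x q, L x = Sum.inr q → blk x = some q ∧ τ q ≤ x ∧ x < N) {i : Fin d} {l m : ℕ}
    {q : Fin k ×ₗ Fin d} (hl : InBlock blk i l) (hq : L l = Sum.inr q) :
    ∃ m', q = toLex (m', i) ∧ (l < nodeLength N τ i m → (m' : ℕ) < m) ∧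
      (l = nodeLength N τ i m → (m' : ℕ) ≤ m) := by
  obtain ⟨m', hm'⟩ := hl
  have h := hb _ _ hq
  obtain rfl : toLex (m', i) = q := by
    have := hm'.symm.trans h.1
    simpa using this
  refine ⟨m', rfl, fun hl => ?_, fun hl => ?_⟩
  · by_contra hc
    have hmk : m < k := by omega
    rw [nodeLength, dif_pos hmk] at hl
    have : τ (toLex (⟨m, hmk⟩, i)) ≤ τ (toLex (m', i)) := by
      apply hτ.monotone
      rw [Prod.Lex.toLex_le_toLex]
      rcases (not_lt.1 hc).lt_or_eq with h' | h'
      · exact Or.inl h'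
      · exact Or.inr ⟨Fin.ext h', le_rfl⟩
    omega
  · by_contra hc
    have hmk : m < k := by omega
    rw [nodeLength, dif_pos hmk] at hl
    have : τ (toLex (⟨m, hmk⟩, i)) < τ (toLex (m', i)) := by
      apply hτ
      rw [Prod.Lex.toLex_lt_toLex]
      exact Or.inl (not_le.1 hc)
    omega

variable [NeZero b]

open Classical in
/-- The entry at position `l` of the nodes above `s` in the `i`-th tree. -/
noncomputable def direction (L : ℕ → (Λ × Fin b) ⊕ (Fin k ×ₗ Fin d))
    (blk : ℕ → Option (Fin k ×ₗ Fin d)) (i : Fin d) (s : List (Fin b)) (l : ℕ) : Fin b :=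
  if InBlock blk i l then Sum.elim Prod.snd (fun q => s.getD (ofLex q).1 0) (L l) else 0

/-- The node of the `i`-th tree corresponding to `s`. -/
noncomputable def node (N : ℕ) (L : ℕ → (Λ × Fin b) ⊕ (Fin k ×ₗ Fin d)) (τ : Fin k ×ₗ Fin d → ℕ)
    (blk : ℕ → Option (Fin k ×ₗ Fin d)) (i : Fin d) (s : List (Fin b)) : List (Fin b) :=
  pathOf (direction L blk i s) (nodeLength N τ i s.length)

theorem nodeLength_lt (hτ : StrictMono τ) (hτN : ∀ q, τ q < N) (i j : Fin d) {m m' : ℕ}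
    (h : m < m') (hm' : m' ≤ k) : nodeLength N τ i m < nodeLength N τ j m' := by
  have hm : m < k := by omega
  simp only [nodeLength, hm, dite_true]
  split_ifs with h'
  · apply hτ
    rw [Prod.Lex.toLex_lt_toLex]
    exact Or.inl h
  · exact hτN _

/-- Below the end of the node of `s` only variables of height less than `s.length` occur, so
appending `j` changes nothing there. At the end, the first occurrence of the variable `(s.length,
i)` supplies the direction `j`. -/
theorem isTreeMap_node (hτ : StrictMono τ) (hτN : ∀ q, τ q < N) (hL : ∀ q, L (τ q) = Sum.inr q)
    (hb : ∀ x q, L x = Sum.inr q → blk x = some q ∧ τ q ≤ x ∧ x < N) (i : Fin d) :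
    IsTreeMap k (node N L τ blk i) := by
  intro s j hs
  have h1 : pathOf (direction L blk i s) (nodeLength N τ i s.length) =
      pathOf (direction L blk i (s ++ [j])) (nodeLength N τ i s.length) := by
    apply pathOf_congr
    intro l hl
    unfold direction
    split_ifs with h
    · cases hx : L l with
      | inl x => rfl
      | inr q =>
        obtain ⟨m', rfl, h1, -⟩ := var_lt hτ hb h hx (m := s.length)
        have := h1 hl
        simp only [Sum.elim_inr, ofLex_toLex, List.getD_append _ _ _ _ this]
    · rfl
  have h2 : direction L blk i (s ++ [j]) (nodeLength N τ i s.length) = j := by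
    have h3 : nodeLength N τ i s.length = τ (toLex (⟨s.length, hs⟩, i)) := dif_pos hs
    have h4 := (hb _ _ (hL (toLex (⟨s.length, hs⟩, i)))).1
    rw [h3, direction, if_pos ⟨_, h4⟩, hL]
    simp
  have h3 : node N L τ blk i s ++ [j] =
      pathOf (direction L blk i (s ++ [j])) (nodeLength N τ i s.length + 1) := by
    rw [pathOf_succ, h2, node, h1]
  rw [h3]
  refine pathOf_prefix (Nat.succ_le_of_lt (nodeLength_lt hτ hτN i i ?_ ?_))
  · simp
  · simpa using hs

open Classical in
/-- The embedding given by a word `L` with one block for each height and each tree. -/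
noncomputable def nodeEmb [Inhabited Λ] (L : ℕ → (Λ × Fin b) ⊕ (Fin k ×ₗ Fin d))
    (τ : Fin k ×ₗ Fin d → ℕ)
    (blk : ℕ → Option (Fin k ×ₗ Fin d)) (hτ : StrictMono τ) (hτN : ∀ q, τ q < N)
    (hL : ∀ q, L (τ q) = Sum.inr q)
    (hb : ∀ x q, L x = Sum.inr q → blk x = some q ∧ τ q ≤ x ∧ x < N) : Emb d b k N Λ where
  e := node N L τ blk
  f i v := if InBlock blk i v.length then
      Sum.elim (fun x => Sum.inl x.1) (fun q => varAt (node N L τ blk i) (ofLex q).1 v)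
        (L v.length)
    else Sum.inl default
  isTreeMap := isTreeMap_node hτ hτN hL hb
  length_eq i s hs := by simp [node, nodeLength, hs]
  lt i j s t hst ht := by
    simp only [node, length_pathOf]
    exact nodeLength_lt hτ hτN i j hst ht
  le i j s t hst ht h := by
    simp only [node, length_pathOf, hst]
    unfold nodeLength
    split_ifs with h'
    · apply hτ.monotone
      rw [Prod.Lex.toLex_le_toLex]
      exact Or.inr ⟨rfl, h.elim le_of_lt fun h => h.1.le⟩
    · exact le_rfl
  f_e i s hs := by
    have h3 : (node N L τ blk i s).length = τ (toLex (⟨s.length, hs⟩, i)) := by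
      simp [node, nodeLength, hs]
    have h4 := (hb _ _ (hL (toLex (⟨s.length, hs⟩, i)))).1
    rw [if_pos ⟨_, h3 ▸ h4⟩, h3, hL]
    exact varAt_eq (isTreeMap_node hτ hτN hL hb i) hs.le List.prefix_rfl
  e_prefix i v s hv h := by
    split_ifs at h with h1
    cases hx : L v.length with
    | inl x => simp [hx] at h
    | inr q =>
      rw [hx, Sum.elim_inr] at h
      have h2 := of_varAt_eq h
      exact ⟨by rw [h2.1]; exact (ofLex q).1.2, h2.2⟩

open Classical in
-- A variable met on the path to `s` has already had its first occurrence, so the node it belongs to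
-- is an initial segment of `s`. Along the path, words in a tree thus behave like words indexed by
-- `ℕ`.
theorem word_nodeEmb [Inhabited Λ] (hτ : StrictMono τ) (hτN : ∀ q, τ q < N)
    (hL : ∀ q, L (τ q) = Sum.inr q)
    (hb : ∀ x q, L x = Sum.inr q → blk x = some q ∧ τ q ≤ x ∧ x < N)
    (a : Fin d → List (Fin b) → Λ) (i : Fin d) {v s : List (Fin b)} (hs : s.length ≤ k)
    (h : v <+: node N L τ blk i s) :
    (nodeEmb L τ blk hτ hτN hL hb).word a i v = if InBlock blk i v.length then
      Sum.elim Prod.fst (fun q => a i (s.take (ofLex q).1)) (L v.length) else default := by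
  by_cases h1 : InBlock blk i v.length
  · cases hx : L v.length with
    | inl x => simp [Emb.word, nodeEmb, h1, hx]
    | inr q =>
      have hl := h.length_le
      simp only [node, length_pathOf] at hl
      obtain ⟨m', rfl, h2, h3⟩ := var_lt hτ hb h1 hx (m := s.length)
      have hm : (m' : ℕ) ≤ s.length := by
        rcases hl.lt_or_eq with h' | h'
        · exact (h2 h').le
        · exact h3 h'
      have hlen : (s.take m').length = m' := by simpa using hm
      have hT := isTreeMap_node hτ hτN hL hb i
      have hpre : node N L τ blk i (s.take m') <+: v := by
        refine List.prefix_of_prefix_length_le (hT.prefix_map (List.take_prefix _ _) hs) h ?_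
        rw [node, length_pathOf, hlen, nodeLength, dif_pos m'.2]
        exact (hb _ _ hx).2.1
      have h5 := varAt_eq (Λ := Λ) hT (hlen.trans_le m'.2.le) hpre
      rw [hlen] at h5
      simp [Emb.word, nodeEmb, h1, hx, h5]
  · simp [Emb.word, nodeEmb, h1]

end GoodEmb

/-- The colour of `(a, z)` depends on `z i` and `a i (z i)` only if `z i` is not a leaf. -/
def Good {d b : ℕ} {Λ : Type} {κ : Type*} (k : ℕ)
    (c : (Fin d → List (Fin b) → Λ) → (Fin d → List (Fin b)) → κ) : Prop :=
  ∀ a a' z z', (∀ i, ((z i).length = k ∧ (z' i).length = k) ∨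
    ((z i).length < k ∧ z i = z' i ∧ a i (z i) = a' i (z i))) → c a z = c a' z'

/-- Letter and direction are handled together over `Λ × Fin b`. The parameter `e` records the
heights of the `z i`; a leaf contributes nothing to `R e`, as no variable has height `k`. -/
theorem exists_good_of_insens {Λ : Type} [Inhabited Λ] [Finite Λ] (κ : Type) [Finite κ]
    (d b : ℕ) [NeZero b] (k : ℕ) :
    ∃ N : ℕ, ∀ c : (Fin d → List (Fin b) → Λ) → (Fin d → List (Fin b)) → κ, Insens N 0 c →
      ∃ Φ : Emb d b k N Λ, Good k (Φ.pull c) := by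
  classical
  let E := Fin d → Fin (k + 1)
  let R : E → Set (Fin k ×ₗ Fin d) := fun e => {q | ((ofLex q).1 : ℕ) = e (ofLex q).2}
  have : Finite (Fin k ×ₗ Fin d) := inferInstanceAs (Finite (Fin k × Fin d))
  obtain ⟨N, blk, h⟩ := exists_sequential (Λ × Fin b) (Fin k ×ₗ Fin d) E κ R
  refine ⟨N, fun c hc => ?_⟩
  let W : (ℕ → Λ × Fin b) → Fin d → List (Fin b) → Λ := fun u i v =>
    if InBlock blk i v.length then (u v.length).1 else default
  -- Here `τ` is arbitrary; cutting at `N` keeps the paths inside the tree and has no effect for the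
  -- final `τ`.
  let Z : (ℕ → Λ × Fin b) → (Fin k ×ₗ Fin d → ℕ) → E → Fin d → List (Fin b) := fun u τ e i =>
    pathOf (fun l => if InBlock blk i l then (u l).2 else 0) (min N (nodeLength N τ i (e i)))
  have hZ : ∀ u τ e i, (Z u τ e i).length ≤ N := by
    intro u τ e i
    simp only [Z, length_pathOf]
    omega
  obtain ⟨L, τ, hτ, hL, hb, hi⟩ := h (fun u τ e => c (W u) (Z u τ e)) (by
      intro u u' τ τ' e hu hτ
      have h1 : Z u τ e = Z u' τ' e := by
        funext i
        simp only [Z]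
        have h2 : nodeLength N τ i (e i) = nodeLength N τ' i (e i) := by
          unfold nodeLength
          split_ifs with h
          · exact hτ _ rfl
          · rfl
        rw [h2]
        apply pathOf_congr
        intro l hl
        rw [hu l (by omega)]
      rw [h1]
      refine hc _ _ _ (hZ _ _ _) fun i v hv _ => ?_
      simp only [W, hu _ hv])
  have hτN : ∀ q, τ q < N := fun q => (hb _ _ (hL q)).2.2
  let Φ := nodeEmb L τ blk hτ hτN hL hb
  refine ⟨Φ, ?_⟩
  let α : (Fin d → List (Fin b) → Λ) → (Fin d → List (Fin b)) → Fin k ×ₗ Fin d → Λ × Fin b :=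
    fun a z q => (a (ofLex q).2 ((z (ofLex q).2).take (ofLex q).1),
      (z (ofLex q).2).getD (ofLex q).1 0)
  have key : ∀ (e : E) a z, (∀ i, (z i).length = (e i : ℕ)) →
      Φ.pull c a z = c (W (fill L (α a z))) (Z (fill L (α a z)) τ e) := by
    intro e a z he
    have hz : ∀ i, (z i).length ≤ k := fun i => by
      rw [he i]
      exact Nat.le_of_lt_succ (e i).2
    have h1 : (fun i => Φ.e i (z i)) = Z (fill L (α a z)) τ e := by
      funext i
      have h2 : nodeLength N τ i (e i) ≤ N := by
        unfold nodeLength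
        split_ifs
        · exact (hτN _).le
        · exact le_rfl
      change node N L τ blk i (z i) = _
      simp only [node, Z, he, min_eq_right h2]
      apply pathOf_congr
      intro l _
      unfold direction
      split_ifs with h3
      · cases hx : L l with
        | inl x => simp [fill, hx]
        | inr q =>
          obtain ⟨m', rfl, -, -⟩ := var_lt hτ hb h3 hx (m := 0)
          simp [fill, hx, α]
      · rfl
    rw [← h1]
    refine hc _ _ _ (fun i => Φ.length_le i (hz i)) fun i v hv hvp => ?_
    rw [word_nodeEmb hτ hτN hL hb a i (hz i) (hvp.resolve_left (by omega))]
    simp only [W]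
    split_ifs with h3
    · cases hx : L v.length with
      | inl x => simp [fill, hx]
      | inr q =>
        obtain ⟨m', rfl, -, -⟩ := var_lt hτ hb h3 hx (m := 0)
        simp [fill, hx, α]
    · rfl
  intro a a' z z' hzz
  have hk : ∀ i, (z i).length < k + 1 := fun i => by rcases hzz i with h | h <;> omega
  have hll : ∀ i, (z' i).length = (z i).length := fun i => by
    rcases hzz i with h | h
    · omega
    · rw [h.2.1]
  let e : E := fun i => ⟨(z i).length, hk i⟩
  rw [key e a z (fun i => rfl), key e a' z' (fun i => hll i)]
  apply hi
  rintro q hq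
  have hq' : ((ofLex q).1 : ℕ) = (z (ofLex q).2).length := hq
  have hqk := (ofLex q).1.2
  obtain ⟨-, h1, h2⟩ := (hzz (ofLex q).2).resolve_left (by omega)
  -- The height of `q` is the length of `z i`, so the segment cut off is `z i` itself and the
  -- direction entry lies past its end.
  simp only [α, ← h1, hq', List.take_length, h2]

/-- The unified theorem: it contains all the mixed products at once. -/
theorem exists_good (Λ : Type) [Inhabited Λ] [Finite Λ] (κ : Type) [Finite κ]
    (d b : ℕ) [NeZero b] (k : ℕ) :
    ∃ n₀ : ℕ, ∀ n, n₀ ≤ n → ∀ c : (Fin d → List (Fin b) → Λ) → (Fin d → List (Fin b)) → κ,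
      Insens n n c → ∃ Φ : Emb d b k n Λ, Good k (Φ.pull c) := by
  obtain ⟨N, hN⟩ := exists_good_of_insens (Λ := Λ) κ d b k
  obtain ⟨n₀, h₀⟩ := exists_insens (Λ := Λ) κ d b N 0
  rw [Nat.zero_add] at h₀
  refine ⟨n₀, fun n hn c hc => ?_⟩
  obtain ⟨Φ, hΦ⟩ := h₀ n hn c hc
  obtain ⟨Ψ, hΨ⟩ := hN _ hΦ
  exact ⟨Φ.comp Ψ, by rwa [Emb.pull_comp]⟩

/-! ### Images of tree maps as complete skew subtrees. -/

namespace IsTreeMap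

variable {b k : ℕ} {g : List (Fin b) → List (Fin b)} {s t : List (Fin b)}

theorem eq_of_map_eq (hg : IsTreeMap k g) (hs : s.length ≤ k) (ht : t.length ≤ k)
    (h : g s = g t) : s = t :=
  (hg.prefix_of_map hs ht (by rw [h])).eq_of_length_le (hg.prefix_of_map ht hs (by rw [h])).length_le

/-- Preimages split in the opposite order would have images split in the opposite order, against the
linear order on lists. -/
theorem lexLE_of_map (hg : IsTreeMap k g) (hs : s.length ≤ k) (hst : s.length = t.length)
    (h : LexLE (g s) (g t)) : LexLE s t := by
  have ht : t.length ≤ k := hst ▸ hs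
  rcases prefix_trichotomy s t with h' | h' | ⟨p, i, j, u, v, hij, rfl, rfl⟩
  · exact Or.inl h'
  · rw [h'.eq_of_length hst.symm]
    exact Or.inl List.prefix_rfl
  · rcases hij.lt_or_gt with hij' | hij'
    · exact Or.inr ⟨p, i, j, u, v, hij', rfl, rfl⟩
    · exfalso
      rcases h with h | ⟨p', i', j', u', v', hij'', h1, h2⟩
      · have := (hg.prefix_of_map hs ht h).eq_of_length hst
        simp at this
        exact hij this.1
      · have h3 : g (p ++ i :: u) < g (p ++ j :: v) := by
          rw [h1, h2]
          exact append_cons_lt _ hij'' _ _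
        obtain ⟨u₁, hu⟩ := hg.append_prefix_map (s := p) (j := i) ⟨u, by simp⟩ hs
        obtain ⟨v₁, hv⟩ := hg.append_prefix_map (s := p) (j := j) ⟨v, by simp⟩ ht
        rw [← hu, ← hv] at h3
        simp only [List.append_assoc, List.singleton_append] at h3
        exact lt_asymm h3 (append_cons_lt _ hij' _ _)

theorem ht_eq (hg : IsTreeMap k g) (hs : s.length ≤ k) :
    ht (g '' {s | s.length ≤ k}) (g s) = s.length := by
  have h1 : pred (g '' {s | s.length ≤ k}) (g s) =
      (fun m => g (s.take m)) '' Set.Iio s.length := by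
    ext x
    constructor
    · rintro ⟨⟨t, ht, rfl⟩, hts, hne⟩
      have h := hg.prefix_of_map ht hs hts
      have hlt : t.length < s.length :=
        lt_of_le_of_ne h.length_le fun he => hne (by rw [h.eq_of_length he])
      exact ⟨t.length, hlt, congrArg g (List.prefix_iff_eq_take.1 h).symm⟩
    · rintro ⟨m, hm, rfl⟩
      have hm' : m < s.length := hm
      have hl : (s.take m).length = m := by simp; omega
      refine ⟨⟨_, ?_, rfl⟩, hg.prefix_map (List.take_prefix _ _) hs, fun he => ?_⟩
      · simp only [Set.mem_ofPred_eq]; omega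
      · have := hg.eq_of_map_eq (by omega) hs he
        rw [this] at hl
        omega
  rw [ht, h1, Set.InjOn.ncard_image]
  · rw [← Finset.coe_Iio, Set.ncard_coe_finset, Nat.card_Iio]
  · intro m hm m' hm' h
    have hm1 : m < s.length := hm
    have hm2 : m' < s.length := hm'
    have := congrArg List.length (hg.eq_of_map_eq (by simp; omega) (by simp; omega) h)
    simp at this
    omega

/-- By maximality `C` contains the root. The longest `s` with `g s ∈ C` must have length `k`, since
otherwise `g (s ++ [0])` could be added; then `C` consists of the images of the initial segments of
`s`. -/
theorem ncard_of_maximal [NeZero b] (hg : IsTreeMap k g) {C : Set (List (Fin b))}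
    (hC : Maximal (fun C' => C' ⊆ g '' {s | s.length ≤ k} ∧ IsChain (fun s t => s <+: t) C') C) :
    C.ncard = k + 1 := by
  have hroot : g [] ∈ C := by
    refine hC.2 (y := insert (g []) C) ⟨Set.insert_subset ⟨[], by simp, rfl⟩ hC.1.1,
      hC.1.2.insert fun x hx _ => Or.inl ?_⟩ (Set.subset_insert _ _) (Set.mem_insert _ _)
    obtain ⟨s, hs, rfl⟩ := hC.1.1 hx
    exact hg.prefix_map List.nil_prefix hs
  let T : Set (List (Fin b)) := {s | s.length ≤ k ∧ g s ∈ C}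
  have hTfin : T.Finite := (List.finite_length_le (Fin b) k).subset fun s hs => hs.1
  obtain ⟨s, hsT, hmax⟩ := hTfin.exists_maximalFor List.length T ⟨[], by simp, hroot⟩
  have hle : ∀ x ∈ C, x <+: g s := by
    intro x hx
    obtain ⟨t, ht, rfl⟩ := hC.1.1 hx
    rcases hC.1.2.total hx hsT.2 with h | h
    · exact h
    · have h' := hg.prefix_of_map hsT.1 ht h
      rw [h'.eq_of_length_le (hmax ⟨ht, hx⟩ h'.length_le)]
  have hsk : s.length = k := by
    by_contra hne
    have hlt : s.length < k := lt_of_le_of_ne hsT.1 hne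
    have hl : (s ++ [(0 : Fin b)]).length ≤ k := by simpa using hlt
    have hmem : g (s ++ [0]) ∈ C := by
      refine hC.2 (y := insert (g (s ++ [0])) C) ⟨Set.insert_subset ⟨_, hl, rfl⟩ hC.1.1,
        hC.1.2.insert fun x hx _ => Or.inr ?_⟩ (Set.subset_insert _ _) (Set.mem_insert _ _)
      exact (hle x hx).trans (hg.prefix_map (List.prefix_append _ _) hl)
    have := hmax (j := s ++ [0]) ⟨hl, hmem⟩ (by simp)
    simp at this
  have hCeq : C = (fun m => g (s.take m)) '' Set.Iic k := by
    apply Set.Subset.antisymm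
    · intro x hx
      obtain ⟨t, ht, rfl⟩ := hC.1.1 hx
      have h := hg.prefix_of_map ht hsT.1 (hle _ hx)
      exact ⟨t.length, ht, congrArg g (List.prefix_iff_eq_take.1 h).symm⟩
    · refine hC.2 (y := (fun m => g (s.take m)) '' Set.Iic k) ⟨?_, ?_⟩ ?_
      · rintro _ ⟨m, hm, rfl⟩
        exact ⟨_, by simp; omega, rfl⟩
      · rintro _ ⟨m, hm, rfl⟩ _ ⟨m', hm', rfl⟩ _
        rcases le_total m m' with h | h
        · exact Or.inl (hg.prefix_map (List.take_prefix_take_left h) (by simp; omega))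
        · exact Or.inr (hg.prefix_map (List.take_prefix_take_left h) (by simp; omega))
      · intro x hx
        obtain ⟨t, ht, rfl⟩ := hC.1.1 hx
        have h := hg.prefix_of_map ht hsT.1 (hle _ hx)
        exact ⟨t.length, ht, congrArg g (List.prefix_iff_eq_take.1 h).symm⟩
  rw [hCeq, Set.InjOn.ncard_image]
  · rw [← Finset.coe_Iic, Set.ncard_coe_finset, Nat.card_Iic]
  · intro m hm m' hm' h
    have hm1 : m ≤ k := hm
    have hm2 : m' ≤ k := hm'
    have := congrArg List.length (hg.eq_of_map_eq (by simp; omega) (by simp; omega) h)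
    simp at this
    omega

/-- Heights in the image are lengths of preimages (`ht_eq`), which turns the level conditions into
`hlt` and `hle`. The successor of `g s` in direction `i` is `g (s ++ [i])`, because every other
image in that direction lies above it. -/
theorem isCompleteSkew [NeZero b] (hg : IsTreeMap k g)
    (hlt : ∀ s t, s.length < t.length → t.length ≤ k → (g s).length < (g t).length)
    (hle : ∀ s t, s.length = t.length → t.length ≤ k → LexLE s t → (g s).length ≤ (g t).length) :
    IsCompleteSkew (k + 1) (g '' {s | s.length ≤ k}) where
  exists_min := by
    refine ⟨g [], ⟨[], by simp, rfl⟩, ?_⟩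
    rintro _ ⟨s, hs, rfl⟩
    exact hg.prefix_map List.nil_prefix hs
  maximal_chain C hC := hg.ncard_of_maximal hC
  same_level := by
    rintro _ ⟨s, hs, rfl⟩ _ ⟨t, ht, rfl⟩ h hst
    rw [hg.ht_eq hs, hg.ht_eq ht] at h
    exact hle s t h ht (hg.lexLE_of_map hs h hst)
  lower_level := by
    rintro _ ⟨s, hs, rfl⟩ _ ⟨t, ht, rfl⟩ h
    rw [hg.ht_eq hs, hg.ht_eq ht] at h
    exact hlt s t h ht
  branching := by
    rintro _ ⟨s, hs, rfl⟩ ⟨_, ⟨t, ht, rfl⟩, hst, hne⟩ i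
    have hst' := hg.prefix_of_map hs ht hst
    have hsk : s.length < k := by
      refine lt_of_lt_of_le (lt_of_le_of_ne hst'.length_le fun he => hne ?_) ht
      rw [hst'.eq_of_length he]
    have hl : (s ++ [i]).length ≤ k := by simpa using hsk
    have hneq : ∀ {t}, s ++ [i] <+: t → t.length ≤ k → g s ≠ g t := by
      intro t h ht he
      have h1 := h.length_le
      rw [hg.eq_of_map_eq hs ht he] at h1
      simp at h1
    refine ⟨g (s ++ [i]), ⟨⟨⟨_, hl, rfl⟩, hg.prefix_map (List.prefix_append _ _) hl,
      hneq List.prefix_rfl hl, ?_⟩, hg s i hsk⟩, ?_⟩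
    · rintro ⟨_, ⟨u, hu, rfl⟩, ⟨h1, h2⟩, h3, h4⟩
      have h1' := hg.prefix_of_map hs hu h1
      have h3' := hg.prefix_of_map hu hl h3
      have h5 : s.length ≠ u.length := fun he => h2 (by rw [h1'.eq_of_length he])
      have h6 : u.length ≠ (s ++ [i]).length := fun he => h4 (by rw [h3'.eq_of_length he])
      have h7 := h1'.length_le
      have h8 := h3'.length_le
      simp only [List.length_append, List.length_singleton] at h6 h8
      omega
    · rintro _ ⟨⟨⟨u, hu, rfl⟩, h1, h2, h3⟩, h4⟩
      have h1' := hg.prefix_of_map hs hu h1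
      obtain ⟨j, hj⟩ := exists_append_singleton_prefix h1' fun he => h2 (by rw [he])
      have h5 := hg.append_prefix_map hj hu
      obtain rfl : i = j := by
        have := (List.prefix_of_prefix_length_le h4 h5 (by simp)).eq_of_length (by simp)
        simpa using this
      by_contra hne
      exact h3 ⟨g (s ++ [i]), ⟨_, hl, rfl⟩,
        ⟨hg.prefix_map (List.prefix_append _ _) hl, hneq List.prefix_rfl hl⟩,
        hg.prefix_map hj hu, fun he => hne he.symm⟩

end IsTreeMap

/-! ### From embeddings to combinatorial subspaces. -/

section Transfer

variable {d b k n ℓ : ℕ} {Λ : Type*} (ψ : Λ ≃ Fin ℓ) (Φ : Emb d b k n (Fin ℓ))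

/-- The leaves of an embedding. -/
def Emb.leaves (i : Fin d) : Set (Leaf b n) := {x | ∃ s, s.length = k ∧ x.1 = Φ.e i s}

theorem Emb.val_image_leaves (i : Fin d) :
    Subtype.val '' Φ.leaves i = Φ.e i '' {s | s.length = k} := by
  ext x
  constructor
  · rintro ⟨t, ⟨s, hs, h⟩, rfl⟩
    exact ⟨s, hs, h.symm⟩
  · rintro ⟨s, hs, rfl⟩
    exact ⟨⟨Φ.e i s, Φ.length_eq i s hs⟩, ⟨s, hs, rfl⟩, rfl⟩

theorem Emb.ncard_leaves (i : Fin d) : (Φ.leaves i).ncard = b ^ k := by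
  rw [← Set.ncard_image_of_injective _ Subtype.val_injective, Φ.val_image_leaves,
    Set.InjOn.ncard_image]
  · have : Nat.card (List.Vector (Fin b) k) = b ^ k := by simp
    exact this
  · intro s hs t ht h
    exact (Φ.isTreeMap i).eq_of_map_eq (le_of_eq hs) (le_of_eq ht) h

variable [NeZero b]

/-- A colouring of a mixed product as a colouring of all tuples of words and sequences. -/
def extendColoring [NeZero n] {κ : Type*} {D : MixedPartition d} (c : MixedWord D b n Λ → κ)
    (a : Fin d → List (Fin b) → Fin ℓ) (z : Fin d → List (Fin b)) : κ :=
  c { w := fun i v => ψ.symm (a i v.1)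
      x := fun i => if h : (z i).length = n then ⟨z i, h⟩ else ⟨List.replicate n 0, by simp⟩
      t := fun i => if h : (z i).length < n then ⟨z i, h⟩ else ⟨[], NeZero.pos n⟩ }

theorem insens_extendColoring [NeZero n] {κ : Type*} {D : MixedPartition d}
    (c : MixedWord D b n Λ → κ) : Insens n n (extendColoring ψ c) := by
  intro a a' z _ h
  unfold extendColoring
  congr 2
  funext i v
  rw [h i v.1 v.2 (Or.inl v.2)]

variable [NeZero ℓ]

/-- The variable words of an embedding. -/
def Emb.varWord (i : Fin d) : PreVarWord b n Λ := fun v =>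
  Sum.elim (fun x => Sum.inl (ψ.symm x)) (fun s =>
    if h : (Φ.e i s).length < n then Sum.inr ⟨Φ.e i s, h⟩ else Sum.inl (ψ.symm 0)) (Φ.f i v.1)

theorem Emb.varWord_eq_inr {i : Fin d} {v t : Node b n} (h : Φ.varWord ψ i v = Sum.inr t) :
    ∃ s, s.length < k ∧ Φ.f i v.1 = Sum.inr s ∧ t.1 = Φ.e i s := by
  unfold Emb.varWord at h
  cases hx : Φ.f i v.1 with
  | inl x => simp [hx] at h
  | inr s =>
    have hs := (Φ.e_prefix i v.1 s v.2 hx).1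
    rw [hx, Sum.elim_inr, dif_pos (Φ.length_lt i hs)] at h
    obtain rfl := Sum.inr.inj h
    exact ⟨s, hs, rfl, rfl⟩

theorem Emb.varWord_e (i : Fin d) {s : List (Fin b)} (hs : s.length < k) :
    Φ.varWord ψ i ⟨Φ.e i s, Φ.length_lt i hs⟩ = Sum.inr ⟨Φ.e i s, Φ.length_lt i hs⟩ := by
  simp [Emb.varWord, Φ.f_e i s hs, Φ.length_lt i hs]

theorem Emb.mem_ws {i : Fin d} {t : Node b n} :
    t ∈ ws (Φ.varWord ψ i) ↔ ∃ s, s.length < k ∧ t.1 = Φ.e i s := by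
  constructor
  · rintro ⟨v, hv⟩
    obtain ⟨s, hs, -, h⟩ := Φ.varWord_eq_inr ψ hv
    exact ⟨s, hs, h⟩
  · rintro ⟨s, hs, h⟩
    obtain rfl : t = ⟨Φ.e i s, Φ.length_lt i hs⟩ := Subtype.ext h
    exact ⟨_, Φ.varWord_e ψ i hs⟩

theorem Emb.wsTree_varWord (i : Fin d) :
    wsTree (Φ.varWord ψ i) = Φ.e i '' {s | s.length < k} := by
  ext x
  constructor
  · rintro ⟨t, ht, rfl⟩
    obtain ⟨s, hs, h⟩ := (Φ.mem_ws ψ).1 ht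
    exact ⟨s, hs, h.symm⟩
  · rintro ⟨s, hs, rfl⟩
    exact ⟨⟨Φ.e i s, Φ.length_lt i hs⟩, (Φ.mem_ws ψ).2 ⟨s, hs, rfl⟩, rfl⟩

theorem Emb.isVarWord (hk : 0 < k) (i : Fin d) : IsVarWord k (Φ.varWord ψ i) := by
  -- Nodes of length less than `k` are those of length at most `k - 1`, which gives a `k`-complete
  -- image; this is where `0 < k` enters.
  obtain ⟨k, rfl⟩ := Nat.exists_eq_succ_of_ne_zero hk.ne'
  refine ⟨?_, fun s t h => ⟨s, h⟩, fun t ht => ?_⟩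
  · rw [Φ.wsTree_varWord]
    simp only [Nat.lt_succ_iff]
    have hT : IsTreeMap k (Φ.e i) := fun s j hs => Φ.isTreeMap i s j (by omega)
    exact hT.isCompleteSkew (fun s t hst ht => Φ.lt i i s t hst (by omega))
      fun s t hst ht h => Φ.le i i s t hst (by omega) (Or.inr ⟨rfl, h⟩)
  · obtain ⟨s, hs, h⟩ := (Φ.mem_ws ψ).1 ht
    obtain rfl : t = ⟨Φ.e i s, Φ.length_lt i hs⟩ := Subtype.ext h
    refine ⟨Φ.varWord_e ψ i hs, fun v hv => ?_⟩
    obtain ⟨s', hs', hf, he⟩ := Φ.varWord_eq_inr ψ hv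
    rw [he]
    exact (Φ.e_prefix i v.1 s' v.2 hf).2

theorem Emb.mem_level (i : Fin d) {m : ℕ} {x : List (Fin b)}
    (hx : x ∈ level (wsTree (Φ.varWord ψ i)) m) : ∃ s, s.length = m ∧ m < k ∧ x = Φ.e i s := by
  obtain ⟨hx, hm⟩ := hx
  rw [Φ.wsTree_varWord] at hx hm
  obtain ⟨s, hs, rfl⟩ := hx
  have hs' : s.length < k := hs
  obtain ⟨k', rfl⟩ := Nat.exists_eq_succ_of_ne_zero (Nat.ne_zero_of_lt hs')
  have hT : IsTreeMap k' (Φ.e i) := fun s j hs => Φ.isTreeMap i s j (by omega)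
  have := hT.ht_eq (Nat.lt_succ_iff.1 hs')
  simp only [Nat.succ_eq_add_one, Nat.lt_succ_iff] at hm
  rw [this] at hm
  exact ⟨s, hm, by omega, rfl⟩

theorem Emb.isMixedVarWord (hk : 0 < k) (D : MixedPartition d) :
    IsMixedVarWord (D := D) k (Φ.varWord ψ) (fun i => Φ.leaves i) where
  varWord := Φ.isVarWord ψ hk
  vector :=
    { complete := fun i => (Φ.isVarWord ψ hk i).1
      same_level := by
        intro i j hij m hm x hx y hy
        obtain ⟨s, hs, hsk, rfl⟩ := Φ.mem_level ψ i hx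
        obtain ⟨t, ht, htk, rfl⟩ := Φ.mem_level ψ j hy
        exact Φ.le i j s t (by omega) (by omega) (Or.inl hij)
      next_level := by
        intro i j m hm x hx y hy
        obtain ⟨s, hs, hsk, rfl⟩ := Φ.mem_level ψ i hx
        obtain ⟨t, ht, htk, rfl⟩ := Φ.mem_level ψ j hy
        exact Φ.lt i j s t (by omega) (by omega) }
  up i := by
    refine ⟨Φ.isVarWord ψ hk i, Φ.ncard_leaves i, ?_⟩
    rw [Φ.wsTree_varWord, Φ.val_image_leaves, ← Set.image_union]
    have : {s : List (Fin b) | s.length < k} ∪ {s | s.length = k} = {s | s.length ≤ k} := by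
      ext s
      simp only [Set.mem_union, Set.mem_ofPred_eq]
      omega
    rw [this]
    exact (Φ.isTreeMap i).isCompleteSkew (fun s t => Φ.lt i i s t)
      fun s t hst ht h => Φ.le i i s t hst ht (Or.inr ⟨rfl, h⟩)

/-- The substituted letters and the chosen nodes all come from the small trees. For `i ∈ D₀` the
colour ignores the sequence, which is taken to be a leaf so that `Good` imposes no condition at `i`.
-/
theorem exists_preimage [NeZero n] {κ : Type*} {D : MixedPartition d} (c : MixedWord D b n Λ → κ)
    {Z : MixedWord D b n Λ} (hZ : Z ∈ mixedSpan (Φ.varWord ψ) (fun i => Φ.leaves i)) :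
    ∃ (a : Fin d → List (Fin b) → Fin ℓ) (ζ : Fin d → List (Fin b)),
      c Z = Φ.pull (extendColoring ψ c) a ζ ∧ (∀ i, i ∉ D.D₂ → (ζ i).length = k) ∧
      ∀ i : {i // i ∈ D.D₂}, (ζ i).length < k ∧ (Z.t i).1 = Φ.e i (ζ i) ∧
        a i (ζ i) = ψ (Z.w i (Z.t i)) := by
  classical
  obtain ⟨hw, hx, ht⟩ := hZ
  choose A hA using hw
  choose x hxk hxe using hx
  choose t htk hte using fun i => (Φ.mem_ws ψ).1 (ht i)
  let a : Fin d → List (Fin b) → Fin ℓ := fun i s =>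
    if h : (Φ.e i s).length < n then ψ (A i ⟨Φ.e i s, h⟩) else 0
  let ζ : Fin d → List (Fin b) := fun i =>
    if h : i ∈ D.D₁ then x ⟨i, h⟩ else if h : i ∈ D.D₂ then t ⟨i, h⟩ else List.replicate k 0
  have hζ₁ : ∀ i : {i // i ∈ D.D₁}, ζ i = x i := fun i => by simp [ζ]
  have hζ₂ : ∀ i : {i // i ∈ D.D₂}, ζ i = t i := fun i => by
    have : (i : Fin d) ∉ D.D₁ := fun h => Finset.disjoint_left.1 D.disjoint₁₂ h i.2
    simp [ζ, this]
  have hword : ∀ i (v : Node b n), Φ.word a i v.1 = ψ (Z.w i v) := by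
    intro i v
    rw [← hA i]
    cases hf : Φ.f i v.1 with
    | inl y => simp [Emb.word, subst, Emb.varWord, hf]
    | inr s =>
      have hs := Φ.length_lt i (Φ.e_prefix i v.1 s v.2 hf).1
      simp [Emb.word, subst, Emb.varWord, hf, a, hs]
  refine ⟨a, ζ, ?_, ?_, ?_⟩
  · unfold Emb.pull extendColoring
    congr 1
    refine MixedWord.ext (funext fun i => funext fun v => ?_)
      (funext fun i => Subtype.ext ?_) (funext fun i => Subtype.ext ?_)
    · simp [hword]
    · have h : (Φ.e i (ζ i)).length = n := by
        rw [hζ₁]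
        exact Φ.length_eq _ _ (hxk i)
      dsimp only
      rw [dif_pos h, hxe i, ← hζ₁]
    · have h : (Φ.e i (ζ i)).length < n := by
        rw [hζ₂]
        exact Φ.length_lt _ (htk i)
      dsimp only
      rw [dif_pos h, hte i, ← hζ₂]
  · intro i hi
    by_cases h : i ∈ D.D₁
    · rw [hζ₁ ⟨i, h⟩]
      exact hxk _
    · simp [ζ, h, hi]
  · intro i
    have h := Φ.length_lt i (htk i)
    refine ⟨by rw [hζ₂]; exact htk i, by rw [hζ₂]; exact hte i, ?_⟩
    rw [← hword, hζ₂, hte i]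
    simp [Emb.word, Φ.f_e i _ (htk i)]

theorem isGood_of_good [NeZero n] {κ : Type*} {D : MixedPartition d} (c : MixedWord D b n Λ → κ)
    (h : Good k (Φ.pull (extendColoring ψ c))) :
    IsGood c (mixedSpan (Φ.varWord ψ) (fun i : {i // i ∈ D.D₁} => Φ.leaves i)) := by
  intro Z hZ Z' hZ' hZZ
  obtain ⟨a, ζ, hc, h1, h2⟩ := exists_preimage ψ Φ c hZ
  obtain ⟨a', ζ', hc', h1', h2'⟩ := exists_preimage ψ Φ c hZ'
  rw [hc, hc']
  apply h
  intro i
  by_cases hi : i ∈ D.D₂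
  · right
    obtain ⟨hk, he, ha⟩ := h2 ⟨i, hi⟩
    obtain ⟨hk', he', ha'⟩ := h2' ⟨i, hi⟩
    obtain ⟨ht, hw⟩ := hZZ ⟨i, hi⟩
    have hζ : ζ i = ζ' i :=
      (Φ.isTreeMap i).eq_of_map_eq hk.le hk'.le (by rw [← he, ← he', ht])
    exact ⟨hk, hζ, ha.trans ((congrArg ψ hw).trans (ha'.symm.trans (by rw [hζ])))⟩
  · exact Or.inl ⟨h1 i hi, h1' i hi⟩

end Transfer

end TreeHJ

theorem mainTheorem3 (d₀ d₁ d₂ : ℕ) (hd : 1 ≤ d₀ + d₁ + d₂)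
    (b ℓ k r : ℕ) (hb : 0 < b) (hℓ : 0 < ℓ) (hk : 0 < k) (hr : 0 < r) :
    ∃ n₀ : ℕ, 0 < n₀ ∧
      ∀ (Λ : Type*) [Fintype Λ], Fintype.card Λ = ℓ →
      ∀ n : ℕ, n₀ ≤ n →
      ∀ D : TreeHJ.MixedPartition (d₀ + d₁ + d₂),
        D.D₀.card = d₀ → D.D₁.card = d₁ → D.D₂.card = d₂ →
      ∀ c : TreeHJ.MixedWord D b n Λ → Fin r,
      ∃ (f : Fin (d₀ + d₁ + d₂) → TreeHJ.PreVarWord b n Λ)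
        (X : {i // i ∈ D.D₁} → Set (TreeHJ.Leaf b n)),
        TreeHJ.IsMixedVarWord k f X ∧ TreeHJ.IsGood c (TreeHJ.mixedSpan f X) := by
  have : NeZero b := ⟨hb.ne'⟩
  have : NeZero ℓ := ⟨hℓ.ne'⟩
  have : Inhabited (Fin ℓ) := ⟨0⟩
  -- The bound is taken for `Fin ℓ` and for all indices together, so it serves every `Λ` and every
  -- partition. Adding one to it makes `n` positive, so that the empty node is available as a
  -- default.
  obtain ⟨n₀, h⟩ := TreeHJ.exists_good (Fin ℓ) (Fin r) (d₀ + d₁ + d₂) b k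
  refine ⟨n₀ + 1, Nat.succ_pos _, fun Λ _ hΛ n hn D _ _ _ c => ?_⟩
  have : NeZero n := ⟨by omega⟩
  let ψ : Λ ≃ Fin ℓ := Fintype.equivFinOfCardEq hΛ
  obtain ⟨Φ, hΦ⟩ := h n (by omega) _ (TreeHJ.insens_extendColoring ψ c)
  exact ⟨Φ.varWord ψ, fun i => Φ.leaves i, Φ.isMixedVarWord ψ hk D,
    TreeHJ.isGood_of_good ψ Φ c hΦ⟩
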